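/- Let $n\ge 1$, $I=\{1,\dots,n\}$, and let $A=(a_{ij})_{n\times n}$ be a real matrix satisfying (H1): $A$ is symmetric, (entrywise) nonnegative, irreducible and invertible. Let $u=(u_1,\dots,u_n)$ be a radial (about the origin) classical solution of $$-\Delta u_i=\sum_{j=1}^n a_{ij}e^{u_j}\ \text{ in }\mathbb R^2,\qquad \int_{\mathbb R^2}e^{u_i}<\infty,\qquad i\in I,$$ and let $\phi=(\phi_1,\dots,\phi_n)$ be a classical solution of the linearized system $$-\Delta\phi_i=\sum_{j=1}^n a_{ij}e^{u_j}\phi_j\ \text{ in }\mathbb R^2,\qquad i\in I.$$ Write $r=|x|$ and $u_i'(r)$ for the derivative of $u_i$ as a function of $r$; the function $u_i'(r)\frac{x_k}{r}=\partial_{x_k}u_i$ is understood to be $0$ at $x=0$. Then: (1) If there are $\tau\in(0,1)$ and $C$ such that $|\phi_i(x)|\le C(1+|x|)^\tau$ for all $x\in\mathbb R^2$, $i\in I$, and $\phi_i(0)=0$ for all $i\in I$, then there exist $c_1,c_2\in\mathbb R$ such that $$\phi_i(x)=c_1u_i'(r)\frac{x_1}{r}+c_2u_i'(r)\frac{x_2}{r},\qquad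 x\in\mathbb R^2,\ i\in I.$$ (2) If there is $C$ such that $|\phi_i(x)|\le C$ for all $x\in\mathbb R^2$, $i\in I$, then there exist $c_0,c_1,c_2\in\mathbb R$ such that $$\phi_i(x)=c_0\bigl(ru_i'(r)+2\bigr)+c_1u_i'(r)\frac{x_1}{r}+c_2u_i'(r)\frac{x_2}{r},\qquad x\in\mathbb R^2,\ i\in I.$$ (3) If $\phi_i(x)=O(|x|^2)$ as $x\to 0$ for all $i\in I$, and there are $\varepsilon_0>0$ and $C$ such that $|\phi_i(x)|\le C(1+|x|)^{2-\varepsilon_0}$ for all $x\in\mathbb R^2$, $i\in I$, then $\phi_i\equiv 0$ for all $i\in I$. -/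

import Mathlib

open scoped Topology Laplacian
open MeasureTheory Asymptotics

noncomputable section

/-- The Euclidean plane. -/
abbrev Plane : Type := EuclideanSpace ℝ (Fin 2)

/-- Hypothesis (H1) on the coefficient matrix: symmetric, entrywise nonnegative, irreducible and
invertible. -/
structure IsH1 {n : ℕ} (A : Matrix (Fin n) (Fin n) ℝ) : Prop where
  symm : A.IsSymm
  nonneg : ∀ i j, 0 ≤ A i j
  irreducible : A.IsIrreducible
  invertible : IsUnit A

/-- `u` is a (classical) finite energy entire solution of the Liouville system
`-Δ u_i = ∑_j a_ij e^{u_j}` in the plane with `∫ e^{u_i} < ∞`. -/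
structure IsLiouvilleSolution {n : ℕ} (A : Matrix (Fin n) (Fin n) ℝ)
    (u : Fin n → Plane → ℝ) : Prop where
  contDiff : ∀ i, ContDiff ℝ 2 (u i)
  equation : ∀ i x, -(Δ (u i)) x = ∑ j, A i j * Real.exp (u j x)
  energy : ∀ i, Integrable (fun x => Real.exp (u i x)) volume

/-- `φ` is a (classical) solution in the plane of the linearized system
`-Δ φ_i = ∑_j a_ij e^{u_j} φ_j`. -/
structure IsLinearizedSolution {n : ℕ} (A : Matrix (Fin n) (Fin n) ℝ)
    (u φ : Fin n → Plane → ℝ) : Prop where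
  contDiff : ∀ i, ContDiff ℝ 2 (φ i)
  equation : ∀ i x, -(Δ (φ i)) x = ∑ j, A i j * Real.exp (u j x) * φ j x

/-- `f` is radial about the origin. -/
def IsRadial (f : Plane → ℝ) : Prop :=
  ∀ x y : Plane, ‖x‖ = ‖y‖ → f x = f y

/-- For a radial function `f`, regarded as a function `f(r)` of `r = |x|`, its derivative `f'(r)`:
the derivative of `f` along the first coordinate axis. -/
def radialDeriv (f : Plane → ℝ) (r : ℝ) : ℝ :=
  deriv (fun s : ℝ => f (EuclideanSpace.single 0 s)) r

/-- For a radial function `f`, the function `f'(r) x_k / r` with `r = |x|`, that is, the partial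
derivative of `f` in the direction of the `k`-th coordinate. At the origin the quotient is `0`,
which is the value (and limit) of this partial derivative for a radial `C²` function. -/
def radialPartial (f : Plane → ℝ) (k : Fin 2) (x : Plane) : ℝ :=
  radialDeriv f ‖x‖ * (x k / ‖x‖)

end

/-!
The proof separates variables. On the circle of radius `r`, the Fourier coefficients of `φ` of
frequency `k` (`circleMode`) solve the radial system
`fᵢ'' + fᵢ' / r - k² fᵢ / r² + ∑ⱼ aᵢⱼ e^{uⱼ} fⱼ = 0`, and `φ` is recovered from them
(`eq_of_circleMode_eq_zero`). The coupling is nonnegative and irreducible, so each of these systems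
obeys a Perron-Frobenius principle: a positive solution is, up to a constant, the only one with the
right behaviour at `0` and at `∞`, and a strict positive supersolution excludes all others. The
system is not self-adjoint, so this is proved by comparison rather than by energy identities
(`CooperativeOperator.IsSolution.eq_const_mul`, `eq_zero_of_strict_supersolution`). At infinity the
comparison is driven by explicit powers of `r`, which are supersolutions because finite energy
forces `r uⱼ'(r) < -2` for large `r` and hence `r² e^{uⱼ} → 0`.

* `k = 1`: the flux identity `r uᵢ' = -∑ⱼ aᵢⱼ ∫₀ʳ s e^{uⱼ}` shows that `-uᵢ'` is a positive
  solution, so modes of growth less than `r` are multiples of it.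
* `k ≥ 2`: the same function is a strict supersolution, so modes of growth less than `r²` vanish.
* `k = 0`: the natural unknowns are the weighted integrals `wᵢ(r) = ∫₀ʳ s e^{uᵢ} fᵢ`, which again
  solve a cooperative system. If `f` is bounded then `w(∞) = 0` since `A` is invertible. The
  function generated by scaling, `f = r u' + 2`, has `wᵢ = r² e^{uᵢ} > 0`, so it spans the bounded
  modes.

Vanishing conditions at the origin remove the modes `k = 0` and `k = 1` by uniqueness for the
singular initial value problem (`eq_zero_of_singular_initial_value`).
-/

/-! ### Cooperative linear systems on the half-line -/

/-- A linear second order operator `v ↦ (vᵢ'' + pᵢ vᵢ' + cᵢ vᵢ + ∑ⱼ bᵢⱼ vⱼ)ᵢ` on `(0, ∞)` whose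
coupling coefficients `bᵢⱼ` are nonnegative. -/
structure CooperativeOperator (ι : Type*) where
  p : ι → ℝ → ℝ
  c : ι → ℝ → ℝ
  b : ι → ι → ℝ → ℝ
  b_nonneg : ∀ i j r, 0 < r → 0 ≤ b i j r

namespace CooperativeOperator

variable {ι : Type*} [Fintype ι]

/-- The value of the operator on a function with first derivative `v'` and second derivative
`v''`. -/
def eval (L : CooperativeOperator ι) (v v' v'' : ι → ℝ → ℝ) (i : ι) (r : ℝ) : ℝ :=
  v'' i r + L.p i r * v' i r + L.c i r * v i r + ∑ j, L.b i j r * v j r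

/-- `v` is a solution of `L v = 0` on `(0, ∞)`, with derivative `v'`. -/
structure IsSolution (L : CooperativeOperator ι) (v v' : ι → ℝ → ℝ) : Prop where
  hasDerivAt : ∀ i r, 0 < r → HasDerivAt (v i) (v' i r) r
  hasDerivAt' : ∀ i r, 0 < r →
    HasDerivAt (v' i) (-(L.p i r * v' i r + L.c i r * v i r + ∑ j, L.b i j r * v j r)) r

lemma IsSolution.const_mul_sub {L : CooperativeOperator ι} {f f' g g' : ι → ℝ → ℝ}
    (hf : L.IsSolution f f') (hg : L.IsSolution g g') (M : ℝ) :
    L.IsSolution (fun i r => M * g i r - f i r) (fun i r => M * g' i r - f' i r) where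
  hasDerivAt i r hr := ((hg.hasDerivAt i r hr).const_mul M).sub (hf.hasDerivAt i r hr)
  hasDerivAt' i r hr := by
    refine (((hg.hasDerivAt' i r hr).const_mul M).sub (hf.hasDerivAt' i r hr)).congr_deriv ?_
    simp only [mul_sub, Finset.sum_sub_distrib]
    have : ∑ j, L.b i j r * (M * g j r) = M * ∑ j, L.b i j r * g j r := by
      rw [Finset.mul_sum]; exact Finset.sum_congr rfl fun j _ => by ring
    rw [this]; ring

lemma IsSolution.neg {L : CooperativeOperator ι} {f f' : ι → ℝ → ℝ} (hf : L.IsSolution f f') :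
    L.IsSolution (fun i r => -f i r) (fun i r => -f' i r) where
  hasDerivAt i r hr := (hf.hasDerivAt i r hr).neg
  hasDerivAt' i r hr := by
    refine (hf.hasDerivAt' i r hr).neg.congr_deriv ?_
    simp only [mul_neg, Finset.sum_neg_distrib]
    ring

end CooperativeOperator

lemma IsLocalMin.deriv_eq_zero_and_second_deriv_nonneg {D D' : ℝ → ℝ} {d r : ℝ}
    (h : ∀ᶠ s in 𝓝 r, HasDerivAt D (D' s) s) (h2 : HasDerivAt D' d r) (hmin : IsLocalMin D r) :
    D' r = 0 ∧ 0 ≤ d := by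
  have hd : deriv D =ᶠ[𝓝 r] D' := h.mono fun s hs => hs.deriv
  have h0 : D' r = 0 := hmin.hasDerivAt_eq_zero h.self_of_nhds
  refine ⟨h0, ?_⟩
  by_contra! hneg
  have hdd : deriv (deriv D) r = d := by rw [hd.deriv_eq]; exact h2.deriv
  have hmax : IsLocalMax D r :=
    isLocalMax_of_deriv_deriv_neg (by rw [hdd]; exact hneg) (by rw [hd.self_of_nhds, h0])
      h.self_of_nhds.continuousAt
  have hconst : D =ᶠ[𝓝 r] fun _ => D r := by
    filter_upwards [hmin, hmax] with s hs hs' using le_antisymm hs' hs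
  have h1 : D' =ᶠ[𝓝 r] fun _ => 0 := by
    filter_upwards [hconst.eventuallyEq_nhds, h] with s hs hs'
    exact hs'.unique ((hasDerivAt_const s (D r)).congr_of_eventuallyEq hs)
  have := h2.unique ((hasDerivAt_const r (0 : ℝ)).congr_of_eventuallyEq h1)
  linarith

namespace CooperativeOperator

variable {ι : Type*} [Fintype ι]

/-- `V` is a positive function, with derivatives `V'` and `V''`, which is a strict supersolution
on `(R, ∞)`. -/
structure IsExteriorBarrier (L : CooperativeOperator ι) (R : ℝ) (V V' V'' : ι → ℝ → ℝ) :
    Prop where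
  hasDerivAt : ∀ i r, 0 < r → HasDerivAt (V i) (V' i r) r
  hasDerivAt' : ∀ i r, 0 < r → HasDerivAt (V' i) (V'' i r) r
  eval_neg : ∀ i r, R < r → L.eval V V' V'' i r < 0
  pos : ∀ i r, 0 < r → 0 < V i r

/-- `S` is a positive solution, with derivatives `S'` and `S''`, of the decoupled equations
`Sᵢ'' + pᵢ Sᵢ' + cᵢ Sᵢ = 0`, and `m` is a positive weight with `mᵢ' = pᵢ mᵢ`, which puts these
equations into divergence form. -/
structure IsDecoupledSolution (L : CooperativeOperator ι) (S S' S'' m : ι → ℝ → ℝ) : Prop where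
  hasDerivAt : ∀ i r, 0 < r → HasDerivAt (S i) (S' i r) r
  hasDerivAt' : ∀ i r, 0 < r → HasDerivAt (S' i) (S'' i r) r
  eq_zero : ∀ i r, 0 < r → S'' i r + L.p i r * S' i r + L.c i r * S i r = 0
  pos : ∀ i r, 0 < r → 0 < S i r
  weight : ∀ i r, 0 < r → HasDerivAt (m i) (L.p i r * m i r) r
  weight_pos : ∀ i r, 0 < r → 0 < m i r

/-- Comparison on an exterior interval. A supersolution `w` which is nonnegative at `R` and small
at infinity against a strict positive supersolution `V` is nonnegative on `[R, ∞)`: a negative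
minimum of the quotients `wᵢ / Vᵢ` would be attained, and would contradict the second derivative
test. -/
theorem nonneg_of_exterior_supersolution (L : CooperativeOperator ι) {R : ℝ} (hR : 0 < R)
    {w w' w'' V V' V'' : ι → ℝ → ℝ}
    (hw : ∀ i r, 0 < r → HasDerivAt (w i) (w' i r) r)
    (hw' : ∀ i r, 0 < r → HasDerivAt (w' i) (w'' i r) r)
    (hwL : ∀ i r, R < r → L.eval w w' w'' i r ≤ 0)
    (hV : L.IsExteriorBarrier R V V' V'')
    (hlim : ∀ i, Filter.Tendsto (fun r => w i r / V i r) Filter.atTop (𝓝 0))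
    (hwR : ∀ i, 0 ≤ w i R) :
    ∀ i r, R ≤ r → 0 ≤ w i r := by
  by_contra! hcon
  obtain ⟨i₀, r₁, hr₁, hneg⟩ := hcon
  set h : ι → ℝ → ℝ := fun i r => w i r / V i r with hh
  have hμ : h i₀ r₁ < 0 := div_neg_of_neg_of_pos hneg (hV.pos i₀ r₁ (hR.trans_le hr₁))
  have hev : ∀ᶠ r in Filter.atTop, ∀ i, h i₀ r₁ < h i r := by
    rw [Filter.eventually_all]
    exact fun i => (hlim i).eventually (lt_mem_nhds hμ)
  obtain ⟨R₁, hR₁⟩ := Filter.eventually_atTop.1 hev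
  set R' := max R₁ r₁ with hR'
  have hRR' : R ≤ R' := hr₁.trans (le_max_right _ _)
  have hcont : ∀ i, ContinuousOn (h i) (Set.Icc R R') := fun i r hr =>
    have hr0 : 0 < r := hR.trans_le hr.1
    ((hw i r hr0).continuousAt.div (hV.hasDerivAt i r hr0).continuousAt
      (hV.pos i r hr0).ne').continuousWithinAt
  choose ρ hρ hρmin using fun i =>
    isCompact_Icc.exists_isMinOn (Set.nonempty_Icc.2 hRR') (hcont i)
  obtain ⟨k, -, hk⟩ :=
    Finset.exists_min_image Finset.univ (fun i => h i (ρ i)) ⟨i₀, Finset.mem_univ _⟩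
  set r₀ := ρ k with hr₀
  set m := h k r₀ with hm
  have hmle : m ≤ h i₀ r₁ :=
    (hk i₀ (Finset.mem_univ _)).trans (hρmin i₀ ⟨hr₁, le_max_right _ _⟩)
  have hm0 : m < 0 := hmle.trans_lt hμ
  have hall : ∀ i r, R ≤ r → m ≤ h i r := by
    intro i r hr
    rcases le_total r R' with h1 | h1
    · exact (hk i (Finset.mem_univ _)).trans (hρmin i ⟨hr, h1⟩)
    · exact hmle.trans (hR₁ r ((le_max_left _ _).trans h1) i).le
  have hr₀pos : 0 < r₀ := hR.trans_le (hρ k).1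
  have hRr₀ : R < r₀ := by
    refine lt_of_le_of_ne (hρ k).1 fun heq => ?_
    have : 0 ≤ m := by
      rw [hm, ← heq]; exact div_nonneg (hwR k) (hV.pos k R hR).le
    linarith
  -- `w - m V` is nonnegative, and its `k`-th component vanishes at `r₀`
  have hD : ∀ i r, R ≤ r → 0 ≤ w i r - m * V i r := by
    intro i r hr
    have := (le_div_iff₀ (hV.pos i r (hR.trans_le hr))).1 (hall i r hr)
    linarith
  have hD0 : w k r₀ - m * V k r₀ = 0 := by
    have : m * V k r₀ = w k r₀ := div_mul_cancel₀ _ (hV.pos k r₀ hr₀pos).ne'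
    linarith
  obtain ⟨hd1, hd2⟩ := IsLocalMin.deriv_eq_zero_and_second_deriv_nonneg
    (D := fun r => w k r - m * V k r) (D' := fun r => w' k r - m * V' k r)
    (d := w'' k r₀ - m * V'' k r₀) (r := r₀)
    (by
      filter_upwards [lt_mem_nhds hr₀pos] with s hs
      exact (hw k s hs).sub ((hV.hasDerivAt k s hs).const_mul m))
    ((hw' k r₀ hr₀pos).sub ((hV.hasDerivAt' k r₀ hr₀pos).const_mul m))
    (by
      filter_upwards [lt_mem_nhds hRr₀] with s hs
      rw [hD0]
      exact hD k s hs.le)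
  have hsum : 0 ≤ ∑ j, L.b k j r₀ * (w j r₀ - m * V j r₀) :=
    Finset.sum_nonneg fun j _ => mul_nonneg (L.b_nonneg k j r₀ hr₀pos) (hD j r₀ hRr₀.le)
  have hsum' : ∑ j, L.b k j r₀ * (w j r₀ - m * V j r₀)
      = ∑ j, L.b k j r₀ * w j r₀ - m * ∑ j, L.b k j r₀ * V j r₀ := by
    rw [Finset.mul_sum, ← Finset.sum_sub_distrib]
    exact Finset.sum_congr rfl fun j _ => by ring
  have e1 := hwL k r₀ hRr₀
  have e2 := mul_pos_of_neg_of_neg hm0 (hV.eval_neg k r₀ hRr₀)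
  simp only [eval] at e1 e2
  have e3 : w' k r₀ = m * V' k r₀ := by linarith
  have e4 : w k r₀ = m * V k r₀ := by linarith
  rw [e3, e4] at e1
  nlinarith

/-- If `v` is a nonnegative solution, then `vᵢ / S` decreases for every positive solution `S` of
the decoupled scalar equation such that the weighted Wronskian of `vᵢ` and `S` tends to `0` at the
origin: this Wronskian is decreasing, since the coupling terms are nonnegative. -/
theorem IsSolution.antitoneOn_div {L : CooperativeOperator ι} {v v' : ι → ℝ → ℝ}
    (hv : L.IsSolution v v') (hnn : ∀ i r, 0 < r → 0 ≤ v i r) {S S' S'' m : ι → ℝ → ℝ}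
    (hS : L.IsDecoupledSolution S S' S'' m) (i : ι)
    (hlim : Filter.Tendsto (fun r => m i r * (v' i r * S i r - v i r * S' i r)) (𝓝[>] 0) (𝓝 0)) :
    AntitoneOn (fun r => v i r / S i r) (Set.Ioi 0) := by
  set Q : ℝ → ℝ := fun r => m i r * (v' i r * S i r - v i r * S' i r) with hQ
  have hQd : ∀ r, 0 < r → HasDerivAt Q (-(m i r * S i r * ∑ j, L.b i j r * v j r)) r := by
    intro r hr
    refine ((hS.weight i r hr).mul (((hv.hasDerivAt' i r hr).mul (hS.hasDerivAt i r hr)).sub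
      ((hv.hasDerivAt i r hr).mul (hS.hasDerivAt' i r hr)))).congr_deriv ?_
    have := hS.eq_zero i r hr
    have h2 : S'' i r = -(L.p i r * S' i r + L.c i r * S i r) := by linarith
    simp only [Pi.mul_apply, Pi.sub_apply]
    rw [h2]; ring
  have hsum : ∀ r, 0 < r → 0 ≤ ∑ j, L.b i j r * v j r := fun r hr =>
    Finset.sum_nonneg fun j _ => mul_nonneg (L.b_nonneg i j r hr) (hnn j r hr)
  have hQanti : AntitoneOn Q (Set.Ioi 0) := by
    refine antitoneOn_of_hasDerivWithinAt_nonpos (convex_Ioi 0)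
      (fun r hr => (hQd r hr).continuousAt.continuousWithinAt)
      (fun r hr => (hQd r (interior_subset hr)).hasDerivWithinAt) fun r hr => ?_
    have hr0 : 0 < r := interior_subset hr
    have := mul_nonneg (mul_nonneg (hS.weight_pos i r hr0).le (hS.pos i r hr0).le) (hsum r hr0)
    linarith
  have hQ0 : ∀ r, 0 < r → Q r ≤ 0 := by
    intro r hr
    refine ge_of_tendsto hlim ?_
    filter_upwards [Ioo_mem_nhdsGT hr] with s hs
    exact hQanti hs.1 hr hs.2.le
  refine antitoneOn_of_hasDerivWithinAt_nonpos (convex_Ioi 0)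
    (f' := fun r => (v' i r * S i r - v i r * S' i r) / S i r ^ 2)
    (fun r hr => ((hv.hasDerivAt i r hr).div (hS.hasDerivAt i r hr)
      (hS.pos i r hr).ne').continuousAt.continuousWithinAt)
    (fun r hr => ((hv.hasDerivAt i r (interior_subset hr)).div
      (hS.hasDerivAt i r (interior_subset hr))
      (hS.pos i r (interior_subset hr)).ne').hasDerivWithinAt) fun r hr => ?_
  have hr0 : 0 < r := interior_subset hr
  refine div_nonpos_of_nonpos_of_nonneg ?_ (sq_nonneg _)
  exact nonpos_of_mul_nonpos_right (hQ0 r hr0) (hS.weight_pos i r hr0)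

/-- One half of `IsSolution.eq_const_mul`: if `M` is the least constant with `f ≤ M g` on `(0, R]`,
then `M g - f` is a nonnegative solution on `(0, ∞)`. By minimality of `M` one of its components
vanishes at `R`, hence on `[R, ∞)`, and by irreducibility all components do. -/
theorem IsSolution.exists_le_const_mul [Nonempty ι] {L : CooperativeOperator ι}
    {f f' g g' : ι → ℝ → ℝ}
    (hf : L.IsSolution f f') (hg : L.IsSolution g g') (hgpos : ∀ i r, 0 < r → 0 < g i r)
    {R : ℝ} (hR : 0 < R)
    {S S' S'' m : ι → ℝ → ℝ} (hS : L.IsDecoupledSolution S S' S'' m)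
    (hflim : ∀ i, Filter.Tendsto (fun r => m i r * (f' i r * S i r - f i r * S' i r))
      (𝓝[>] 0) (𝓝 0))
    (hglim : ∀ i, Filter.Tendsto (fun r => m i r * (g' i r * S i r - g i r * S' i r))
      (𝓝[>] 0) (𝓝 0))
    {V V' V'' : ι → ℝ → ℝ}
    (hV : L.IsExteriorBarrier R V V' V'')
    (hfV : ∀ i, Filter.Tendsto (fun r => f i r / V i r) Filter.atTop (𝓝 0))
    (hgV : ∀ i, Filter.Tendsto (fun r => g i r / V i r) Filter.atTop (𝓝 0))
    {K K' : ℝ} (hfg : ∀ i r, 0 < r → r ≤ R → f i r ≤ K * g i r)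
    (hgS : ∀ i r, 0 < r → r ≤ R → g i r ≤ K' * S i r)
    (hirr : ∀ Z : Set ι, Z.Nonempty →
      (∀ i ∈ Z, ∀ j, (∀ r, R < r → 0 < L.b i j r) → j ∈ Z) → Z = Set.univ) :
    ∃ M, (∀ i r, 0 < r → f i r ≤ M * g i r) ∧ ∀ i r, R < r → f i r = M * g i r := by
  -- the set of admissible constants is closed, nonempty and bounded below
  set T : Set ℝ := {M | ∀ i r, 0 < r → r ≤ R → f i r ≤ M * g i r} with hT
  have hTne : T.Nonempty := ⟨K, hfg⟩
  obtain ⟨i₀⟩ := ‹Nonempty ι›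
  have hTbdd : BddBelow T := by
    refine ⟨f i₀ R / g i₀ R, fun M hM => ?_⟩
    rw [div_le_iff₀ (hgpos i₀ R hR)]
    exact hM i₀ R hR le_rfl
  have hTclosed : IsClosed T := by
    simp only [hT, Set.ofPred_forall]
    refine isClosed_iInter fun i => isClosed_iInter fun r => isClosed_iInter fun _ =>
      isClosed_iInter fun _ => isClosed_le continuous_const (continuous_id.mul continuous_const)
  set M := sInf T with hM
  have hMT : M ∈ T := hTclosed.csInf_mem hTne hTbdd
  have hv := hf.const_mul_sub hg M
  set v : ι → ℝ → ℝ := fun i r => M * g i r - f i r with hvdef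
  set v' : ι → ℝ → ℝ := fun i r => M * g' i r - f' i r with hv'def
  have hvext : ∀ i r, R ≤ r → 0 ≤ v i r := by
    refine L.nonneg_of_exterior_supersolution hR hv.hasDerivAt hv.hasDerivAt' ?_ hV
      ?_ ?_
    · intro i r _
      simp only [eval]
      linarith
    · intro i
      have := ((hgV i).const_mul M).sub (hfV i)
      simp only [mul_zero, sub_zero] at this
      refine this.congr fun r => ?_
      simp only [hvdef]; ring
    · intro i
      have := hMT i R hR le_rfl
      simp only [hvdef]; linarith
  have hvnn : ∀ i r, 0 < r → 0 ≤ v i r := by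
    intro i r hr
    rcases le_total r R with h | h
    · have := hMT i r hr h
      simp only [hvdef]; linarith
    · exact hvext i r h
  have hanti : ∀ i, AntitoneOn (fun r => v i r / S i r) (Set.Ioi 0) := by
    intro i
    refine hv.antitoneOn_div hvnn hS i ?_
    have := ((hglim i).const_mul M).sub (hflim i)
    simp only [mul_zero, sub_zero] at this
    refine this.congr fun r => ?_
    simp only [hvdef, hv'def]; ring
  have hzero : ∀ i, v i R = 0 → ∀ r, R < r → v i r = 0 := by
    intro i hi r hr
    have h1 := hanti i (Set.mem_Ioi.2 hR) (Set.mem_Ioi.2 (hR.trans hr)) hr.le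
    simp only [hi, zero_div] at h1
    refine le_antisymm ?_ (hvnn i r (hR.trans hr))
    by_contra! hpos
    exact absurd (div_pos hpos (hS.pos i r (hR.trans hr))) (not_lt.2 h1)
  obtain ⟨i₁, hi₁⟩ : ∃ i, v i R = 0 := by
    by_contra! hne
    have hpos : ∀ i, 0 < v i R := fun i => lt_of_le_of_ne (hvnn i R hR) (hne i).symm
    -- all components are bounded below by a multiple of `S`, hence of `g`: `M` can be lowered
    obtain ⟨i₂, -, hi₂⟩ := Finset.exists_min_image Finset.univ (fun i => v i R / S i R)
      ⟨i₀, Finset.mem_univ _⟩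
    set d := v i₂ R / S i₂ R with hd
    have hdpos : 0 < d := div_pos (hpos i₂) (hS.pos i₂ R hR)
    have hlow : ∀ i r, 0 < r → r ≤ R → d * S i r ≤ v i r := by
      intro i r hr hrR
      rw [← le_div_iff₀ (hS.pos i r hr)]
      exact (hi₂ i (Finset.mem_univ _)).trans (hanti i (Set.mem_Ioi.2 hr) (Set.mem_Ioi.2 hR) hrR)
    have hK' : 0 < K' := by
      by_contra! hK'
      have h1 := hgS i₀ R hR le_rfl
      have h2 := hgpos i₀ R hR
      have h3 := hS.pos i₀ R hR
      nlinarith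
    have : M - d / K' ∈ T := by
      intro i r hr hrR
      have h1 := hlow i r hr hrR
      have h2 : d / K' * g i r ≤ d * S i r := by
        rw [div_mul_eq_mul_div, div_le_iff₀ hK']
        nlinarith [hgS i r hr hrR]
      simp only [hvdef] at h1
      linarith
    have h3 := csInf_le hTbdd this
    have h4 : 0 < d / K' := div_pos hdpos hK'
    linarith
  have hall : {i | ∀ r, R < r → v i r = 0} = Set.univ := by
    refine hirr _ ⟨i₁, hzero i₁ hi₁⟩ fun i hi j hij r hr => ?_
    have hr0 := hR.trans hr
    have e0 : v i =ᶠ[𝓝 r] fun _ => 0 := by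
      filter_upwards [lt_mem_nhds hr] with s hs using hi s hs
    have e1 : v' i =ᶠ[𝓝 r] fun _ => 0 := by
      filter_upwards [e0.eventuallyEq_nhds, lt_mem_nhds hr0] with s hs hs'
      exact (hv.hasDerivAt i s hs').unique ((hasDerivAt_const s (0 : ℝ)).congr_of_eventuallyEq hs)
    have e2 := (hv.hasDerivAt' i r hr0).unique
      ((hasDerivAt_const r (0 : ℝ)).congr_of_eventuallyEq e1)
    simp only [e0.self_of_nhds, e1.self_of_nhds, mul_zero, zero_add, neg_eq_zero] at e2
    rw [Finset.sum_eq_zero_iff_of_nonneg fun j _ =>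
      mul_nonneg (L.b_nonneg i j r hr0) (hvnn j r hr0)] at e2
    exact (mul_eq_zero.1 (e2 j (Finset.mem_univ _))).resolve_left (hij r hr).ne'
  refine ⟨M, fun i r hr => ?_, fun i r hr => ?_⟩
  · have := hvnn i r hr
    simp only [hvdef] at this; linarith
  · have h1 : i ∈ {i | ∀ r, R < r → v i r = 0} := hall ▸ Set.mem_univ i
    have := h1 r hr
    simp only [hvdef] at this; linarith

/-- Positive solutions are the only ones, up to a constant: a solution `f` which is comparable to a
positive solution `g` near the origin and, together with `g`, small at infinity against an exterior
barrier, is a multiple of `g`. -/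
theorem IsSolution.eq_const_mul [Nonempty ι] {L : CooperativeOperator ι}
    {f f' g g' : ι → ℝ → ℝ}
    (hf : L.IsSolution f f') (hg : L.IsSolution g g') (hgpos : ∀ i r, 0 < r → 0 < g i r)
    {R : ℝ} (hR : 0 < R)
    {S S' S'' m : ι → ℝ → ℝ} (hS : L.IsDecoupledSolution S S' S'' m)
    (hflim : ∀ i, Filter.Tendsto (fun r => m i r * (f' i r * S i r - f i r * S' i r))
      (𝓝[>] 0) (𝓝 0))
    (hglim : ∀ i, Filter.Tendsto (fun r => m i r * (g' i r * S i r - g i r * S' i r))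
      (𝓝[>] 0) (𝓝 0))
    {V V' V'' : ι → ℝ → ℝ} (hV : L.IsExteriorBarrier R V V' V'')
    (hfV : ∀ i, Filter.Tendsto (fun r => f i r / V i r) Filter.atTop (𝓝 0))
    (hgV : ∀ i, Filter.Tendsto (fun r => g i r / V i r) Filter.atTop (𝓝 0))
    {K K' : ℝ} (hfg : ∀ i r, 0 < r → r ≤ R → |f i r| ≤ K * g i r)
    (hgS : ∀ i r, 0 < r → r ≤ R → g i r ≤ K' * S i r)
    (hirr : ∀ Z : Set ι, Z.Nonempty →
      (∀ i ∈ Z, ∀ j, (∀ r, R < r → 0 < L.b i j r) → j ∈ Z) → Z = Set.univ) :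
    ∃ M, ∀ i r, 0 < r → f i r = M * g i r := by
  obtain ⟨M, hM, hM'⟩ := hf.exists_le_const_mul hg hgpos hR hS hflim hglim hV hfV hgV
    (fun i r hr hrR => (le_abs_self _).trans (hfg i r hr hrR)) hgS hirr
  obtain ⟨N, hN, hN'⟩ := hf.neg.exists_le_const_mul hg hgpos hR hS
    (fun i => by
      have := (hflim i).neg
      rw [neg_zero] at this
      exact this.congr fun r => by ring)
    hglim hV
    (fun i => by
      have := (hfV i).neg
      rw [neg_zero] at this
      exact this.congr fun r => by ring)
    hgV (fun i r hr hrR => (neg_le_abs _).trans (hfg i r hr hrR)) hgS hirr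
  obtain ⟨i₀⟩ := ‹Nonempty ι›
  have hR1 : R < R + 1 := lt_add_one R
  have h1 := hM' i₀ (R + 1) hR1
  have h2 := hN' i₀ (R + 1) hR1
  have h3 := hgpos i₀ (R + 1) (hR.trans hR1)
  have h4 : (M + N) * g i₀ (R + 1) = 0 := by linear_combination -h1 - h2
  have h5 : N = -M := by linarith [(mul_eq_zero.1 h4).resolve_right h3.ne']
  refine ⟨M, fun i r hr => le_antisymm (hM i r hr) ?_⟩
  have := hN i r hr
  rw [h5] at this
  linarith

/-- The upper bound in `IsSolution.eq_zero_of_strict_supersolution`. -/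
lemma IsSolution.le_zero_of_strict_supersolution {L : CooperativeOperator ι}
    {f f' g g' g'' : ι → ℝ → ℝ}
    (hf : L.IsSolution f f') (hg : L.IsExteriorBarrier 0 g g' g'') {R : ℝ} (hR : 0 < R)
    {V V' V'' : ι → ℝ → ℝ} (hV : L.IsExteriorBarrier R V V' V'')
    (hfV : ∀ i, Filter.Tendsto (fun r => f i r / V i r) Filter.atTop (𝓝 0))
    (hgV : ∀ i, Filter.Tendsto (fun r => g i r / V i r) Filter.atTop (𝓝 0))
    (hf0 : ∀ i, Filter.Tendsto (fun r => f i r / g i r) (𝓝[>] 0) (𝓝 0)) :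
    ∀ i r, 0 < r → f i r ≤ 0 := by
  -- bounds of `f` by multiples of `g` propagate from `(0, R]` to `(0, ∞)`
  have key : ∀ M, 0 ≤ M → (∀ i r, 0 < r → r ≤ R → f i r ≤ M * g i r) →
      ∀ i r, 0 < r → f i r ≤ M * g i r := by
    intro M hM h i r hr
    rcases le_total r R with h1 | h1
    · exact h i r hr h1
    have := L.nonneg_of_exterior_supersolution hR (w := fun i r => M * g i r - f i r)
      (fun i r hr => ((hg.hasDerivAt i r hr).const_mul M).sub (hf.hasDerivAt i r hr))
      (fun i r hr => ((hg.hasDerivAt' i r hr).const_mul M).sub (hf.hasDerivAt' i r hr)) ?_ hV ?_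
      (fun i => by have := h i R hR le_rfl; linarith) i r h1
    · linarith
    · intro i r hr
      have h2 := mul_nonpos_of_nonneg_of_nonpos hM (hg.eval_neg i r (hR.trans hr)).le
      simp only [eval] at h2 ⊢
      have : ∑ j, L.b i j r * (M * g j r - f j r)
          = M * ∑ j, L.b i j r * g j r - ∑ j, L.b i j r * f j r := by
        rw [Finset.mul_sum, ← Finset.sum_sub_distrib]
        exact Finset.sum_congr rfl fun j _ => by ring
      rw [this]
      nlinarith
    · intro i
      have := ((hgV i).const_mul M).sub (hfV i)
      simp only [mul_zero, sub_zero] at this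
      exact this.congr fun r => by ring
  suffices hR0 : ∀ i r, 0 < r → r ≤ R → f i r ≤ 0 by
    intro i r hr
    have := key 0 le_rfl (fun i r hr hrR => by simpa using hR0 i r hr hrR) i r hr
    simpa using this
  by_contra! hcon
  obtain ⟨i₁, r₁, hr₁, hr₁R, hpos⟩ := hcon
  set h : ι → ℝ → ℝ := fun i r => f i r / g i r with hh
  have hμ : 0 < h i₁ r₁ := div_pos hpos (hg.pos i₁ r₁ hr₁)
  have hev : ∀ᶠ r in 𝓝[>] 0, ∀ i, h i r < h i₁ r₁ := by
    rw [Filter.eventually_all]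
    exact fun i => (hf0 i).eventually (gt_mem_nhds hμ)
  obtain ⟨δ₀, hδ₀, hδ⟩ := mem_nhdsGT_iff_exists_Ioo_subset.1 hev
  set δ := min (δ₀ / 2) r₁ with hδdef
  have hδpos : 0 < δ := lt_min (half_pos hδ₀) hr₁
  have hδR : δ ≤ R := (min_le_right _ _).trans hr₁R
  have hcont : ∀ i, ContinuousOn (h i) (Set.Icc δ R) := fun i r hr =>
    have hr0 : 0 < r := hδpos.trans_le hr.1
    ((hf.hasDerivAt i r hr0).continuousAt.div (hg.hasDerivAt i r hr0).continuousAt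
      (hg.pos i r hr0).ne').continuousWithinAt
  choose ρ hρ hρmax using fun i =>
    isCompact_Icc.exists_isMaxOn (Set.nonempty_Icc.2 hδR) (hcont i)
  obtain ⟨k, -, hk⟩ :=
    Finset.exists_max_image Finset.univ (fun i => h i (ρ i)) ⟨i₁, Finset.mem_univ _⟩
  set r₀ := ρ k with hr₀
  set M := h k r₀ with hM
  have hMge : h i₁ r₁ ≤ M :=
    (hρmax i₁ ⟨min_le_right _ _, hr₁R⟩).trans (hk i₁ (Finset.mem_univ _))
  have hM0 : 0 < M := hμ.trans_le hMge
  have hr₀pos : 0 < r₀ := hδpos.trans_le (hρ k).1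
  have hall : ∀ i r, 0 < r → f i r ≤ M * g i r := by
    refine key M hM0.le fun i r hr hrR => ?_
    rw [← div_le_iff₀ (hg.pos i r hr)]
    rcases le_total δ r with h1 | h1
    · exact (hρmax i ⟨h1, hrR⟩).trans (hk i (Finset.mem_univ _))
    · have h2 : h i r < h i₁ r₁ :=
        hδ ⟨hr, (h1.trans (min_le_left _ _)).trans_lt (half_lt_self hδ₀)⟩ i
      exact h2.le.trans hMge
  have hD0 : M * g k r₀ - f k r₀ = 0 := by
    have : M * g k r₀ = f k r₀ := div_mul_cancel₀ _ (hg.pos k r₀ hr₀pos).ne'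
    linarith
  obtain ⟨hd1, hd2⟩ := IsLocalMin.deriv_eq_zero_and_second_deriv_nonneg
    (D := fun r => M * g k r - f k r) (D' := fun r => M * g' k r - f' k r) (r := r₀)
    (by
      filter_upwards [lt_mem_nhds hr₀pos] with s hs
      exact ((hg.hasDerivAt k s hs).const_mul M).sub (hf.hasDerivAt k s hs))
    (((hg.hasDerivAt' k r₀ hr₀pos).const_mul M).sub (hf.hasDerivAt' k r₀ hr₀pos))
    (by
      filter_upwards [lt_mem_nhds hr₀pos] with s hs
      rw [hD0]
      linarith [hall k s hs])
  have hsum : 0 ≤ ∑ j, L.b k j r₀ * (M * g j r₀ - f j r₀) :=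
    Finset.sum_nonneg fun j _ => mul_nonneg (L.b_nonneg k j r₀ hr₀pos) (by
      linarith [hall j r₀ hr₀pos])
  have hsum' : ∑ j, L.b k j r₀ * (M * g j r₀ - f j r₀)
      = M * ∑ j, L.b k j r₀ * g j r₀ - ∑ j, L.b k j r₀ * f j r₀ := by
    rw [Finset.mul_sum, ← Finset.sum_sub_distrib]
    exact Finset.sum_congr rfl fun j _ => by ring
  have e2 := mul_neg_of_pos_of_neg hM0 (hg.eval_neg k r₀ hr₀pos)
  simp only [eval] at e2
  have e3 : f' k r₀ = M * g' k r₀ := by linarith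
  have e4 : f k r₀ = M * g k r₀ := by linarith
  rw [e3, e4] at hd2
  nlinarith

/-- If the operator has a strict positive supersolution `g` on all of `(0, ∞)`, then a solution
which is small against `g` at the origin, and small at infinity against an exterior barrier,
vanishes: a positive multiple of `g` would touch it from above. -/
theorem IsSolution.eq_zero_of_strict_supersolution {L : CooperativeOperator ι}
    {f f' g g' g'' : ι → ℝ → ℝ}
    (hf : L.IsSolution f f') (hg : L.IsExteriorBarrier 0 g g' g'') {R : ℝ} (hR : 0 < R)
    {V V' V'' : ι → ℝ → ℝ} (hV : L.IsExteriorBarrier R V V' V'')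
    (hfV : ∀ i, Filter.Tendsto (fun r => f i r / V i r) Filter.atTop (𝓝 0))
    (hgV : ∀ i, Filter.Tendsto (fun r => g i r / V i r) Filter.atTop (𝓝 0))
    (hf0 : ∀ i, Filter.Tendsto (fun r => f i r / g i r) (𝓝[>] 0) (𝓝 0)) :
    ∀ i r, 0 < r → f i r = 0 := by
  intro i r hr
  refine le_antisymm (hf.le_zero_of_strict_supersolution hg hR hV hfV hgV hf0 i r hr) ?_
  have := hf.neg.le_zero_of_strict_supersolution hg hR hV
    (fun i => by simpa only [neg_div, neg_zero] using (hfV i).neg) hgV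
    (fun i => by simpa only [neg_div, neg_zero] using (hf0 i).neg) i r hr
  linarith

end CooperativeOperator

/-! ### A singular initial value problem -/

/-- Uniqueness for the singular initial value problem `(r ^ m y')' = - r ^ m B(r) y`, `y(0) = 0`,
where `q = r ^ m y'` vanishes at `0`. The integral of `∑ᵢ |yᵢ|` satisfies a Gronwall inequality. -/
theorem eq_zero_of_singular_initial_value {ι : Type*} [Fintype ι] {m : ℕ} {y q : ι → ℝ → ℝ}
    {B : ι → ι → ℝ → ℝ} (hB : ∀ i j, Continuous (B i j))
    (hyc : ∀ i, ContinuousOn (y i) (Set.Ici 0)) (hqc : ∀ i, ContinuousOn (q i) (Set.Ici 0))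
    (hy0 : ∀ i, y i 0 = 0) (hq0 : ∀ i, q i 0 = 0)
    (hy : ∀ i r, 0 < r → HasDerivAt (y i) (q i r / r ^ m) r)
    (hq : ∀ i r, 0 < r → HasDerivAt (q i) (-(r ^ m * ∑ j, B i j r * y j r)) r) :
    ∀ i r, 0 ≤ r → y i r = 0 := by
  intro i₀ R hR
  obtain ⟨K, hK0, hK⟩ : ∃ K, 0 ≤ K ∧ ∀ i j, ∀ r ∈ Set.Icc 0 R, |B i j r| ≤ K := by
    choose K hK using fun i j =>
      (isCompact_Icc (a := (0 : ℝ)) (b := R)).exists_bound_of_continuousOn (hB i j).continuousOn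
    refine ⟨∑ i, ∑ j, |K i j|, by positivity, fun i j r hr => ?_⟩
    calc |B i j r| ≤ K i j := hK i j r hr
      _ ≤ |K i j| := le_abs_self _
      _ ≤ ∑ j, |K i j| := Finset.single_le_sum (f := fun j => |K i j|)
          (fun _ _ => abs_nonneg _) (Finset.mem_univ j)
      _ ≤ _ := Finset.single_le_sum (f := fun i => ∑ j, |K i j|)
          (fun _ _ => Finset.sum_nonneg fun _ _ => abs_nonneg _) (Finset.mem_univ i)
  -- extending `y` by its value at `0` makes all integrands continuous on the line
  set N : ℝ → ℝ := fun r => ∑ j, |y j (max r 0)| with hN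
  have hNc : Continuous N := by
    refine continuous_finsetSum _ fun j _ => Continuous.abs ?_
    exact (hyc j).comp_continuous (continuous_id.max continuous_const) fun r =>
      Set.mem_Ici.2 (le_max_right _ _)
  have hN0 : ∀ r, 0 ≤ N r := fun r => Finset.sum_nonneg fun _ _ => abs_nonneg _
  set Y : ℝ → ℝ := fun r => ∫ s in (0 : ℝ)..r, N s with hY
  have hYd : ∀ r, HasDerivAt Y (N r) r := fun r =>
    intervalIntegral.integral_hasDerivAt_right (hNc.intervalIntegrable _ _)
      hNc.stronglyMeasurable.stronglyMeasurableAtFilter hNc.continuousAt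
  have hYmono : Monotone Y := monotone_of_hasDerivAt_nonneg hYd hN0
  have hY0 : Y 0 = 0 := intervalIntegral.integral_same
  have hqb : ∀ i, ∀ r ∈ Set.Icc 0 R, |q i r| ≤ r ^ m * (K * Y r) := by
    intro i r hr
    have hc : ContinuousOn (fun s => -(s ^ m * ∑ j, B i j s * y j s)) (Set.Icc 0 r) := by
      refine ((continuousOn_pow m).mul (continuousOn_finsetSum _ fun j _ =>
        (hB i j).continuousOn.mul ((hyc j).mono Set.Icc_subset_Ici_self))).neg
    have h1 : ∫ s in (0 : ℝ)..r, -(s ^ m * ∑ j, B i j s * y j s) = q i r - q i 0 :=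
      intervalIntegral.integral_eq_sub_of_hasDerivAt_of_le hr.1
        ((hqc i).mono Set.Icc_subset_Ici_self) (fun s hs => hq i s hs.1)
        (hc.intervalIntegrable_of_Icc hr.1)
    have h2 : ‖∫ s in (0 : ℝ)..r, -(s ^ m * ∑ j, B i j s * y j s)‖
        ≤ ∫ s in (0 : ℝ)..r, r ^ m * K * N s := by
      refine intervalIntegral.norm_integral_le_of_norm_le hr.1 ?_
        ((continuous_const.mul hNc).intervalIntegrable _ _)
      refine Filter.Eventually.of_forall fun s hs => ?_
      rw [norm_neg, norm_mul, norm_pow, Real.norm_eq_abs, abs_of_pos hs.1, mul_assoc]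
      have hr0 : 0 ≤ r ^ m := pow_nonneg hr.1 m
      have hsm : s ^ m ≤ r ^ m := pow_le_pow_left₀ hs.1.le hs.2 m
      refine mul_le_mul hsm ?_ (norm_nonneg _) hr0
      · refine (norm_sum_le _ _).trans ?_
        rw [hN, Finset.mul_sum]
        refine Finset.sum_le_sum fun j _ => ?_
        rw [norm_mul, max_eq_left hs.1.le]
        exact mul_le_mul_of_nonneg_right (hK i j s ⟨hs.1.le, hs.2.trans hr.2⟩) (abs_nonneg _)
    rw [h1, hq0, sub_zero, intervalIntegral.integral_const_mul, Real.norm_eq_abs] at h2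
    linarith
  have hyb : ∀ i, ∀ r ∈ Set.Icc 0 R, |y i r| ≤ R * (K * Y r) := by
    intro i r hr
    have hYr : 0 ≤ Y r := by rw [← hY0]; exact hYmono hr.1
    rcases hr.1.eq_or_lt with h0 | h0
    · rw [← h0, hy0, hY0]; simp
    obtain ⟨c, hc, hc'⟩ := exists_hasDerivAt_eq_slope (y i) (fun s => q i s / s ^ m) h0
      ((hyc i).mono Set.Icc_subset_Ici_self) fun s hs => hy i s hs.1
    rw [hy0, sub_zero, sub_zero, eq_div_iff h0.ne'] at hc'
    rw [← hc', abs_mul, abs_of_pos h0, mul_comm]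
    have hcm : 0 < c ^ m := pow_pos hc.1 m
    have h1 : |q i c / c ^ m| ≤ K * Y r := by
      rw [abs_div, abs_of_pos hcm, div_le_iff₀ hcm]
      calc |q i c| ≤ c ^ m * (K * Y c) := hqb i c ⟨hc.1.le, hc.2.le.trans hr.2⟩
        _ ≤ c ^ m * (K * Y r) := by gcongr; exact hYmono hc.2.le
        _ = _ := mul_comm _ _
    exact mul_le_mul hr.2 h1 (abs_nonneg _) hR
  set C := Fintype.card ι * (R * K) with hC
  have hNb : ∀ r ∈ Set.Icc 0 R, N r ≤ C * Y r := by
    intro r hr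
    calc N r ≤ ∑ _j : ι, R * (K * Y r) :=
          Finset.sum_le_sum fun j _ => by rw [max_eq_left hr.1]; exact hyb j r hr
      _ = C * Y r := by rw [Finset.sum_const, Finset.card_univ, nsmul_eq_mul, hC]; ring
  have hanti : AntitoneOn (fun r => Y r * Real.exp (-(C * r))) (Set.Icc 0 R) := by
    have hd : ∀ r, HasDerivAt (fun r => Y r * Real.exp (-(C * r)))
        (N r * Real.exp (-(C * r)) + Y r * (Real.exp (-(C * r)) * (-(C * 1)))) r := fun r =>
      (hYd r).mul (((hasDerivAt_id r).const_mul C).neg.exp)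
    refine antitoneOn_of_hasDerivWithinAt_nonpos (convex_Icc 0 R)
      (fun r _ => (hd r).continuousAt.continuousWithinAt)
      (fun r _ => (hd r).hasDerivWithinAt) fun r hr => ?_
    have := hNb r (interior_subset hr)
    have hE := Real.exp_pos (-(C * r))
    nlinarith
  have hYR : Y R ≤ 0 := by
    have := hanti ⟨le_rfl, hR⟩ ⟨hR, le_rfl⟩ hR
    simp only [hY0, zero_mul] at this
    exact nonpos_of_mul_nonpos_left this (Real.exp_pos _)
  have hYR' : Y R = 0 := le_antisymm hYR (by rw [← hY0]; exact hYmono hR)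
  have := hyb i₀ R ⟨hR, le_rfl⟩
  rw [hYR', mul_zero, mul_zero] at this
  exact abs_nonpos_iff.1 this

/-! ### Polar coordinates and Fourier modes on circles -/

/-- The radial unit vector `(cos θ, sin θ)`. -/
noncomputable def polarDir (θ : ℝ) : Plane :=
  Real.cos θ • EuclideanSpace.single 0 1 + Real.sin θ • EuclideanSpace.single 1 1

/-- The angular unit vector `(-sin θ, cos θ)`. -/
noncomputable def polarPerp (θ : ℝ) : Plane :=
  -Real.sin θ • EuclideanSpace.single 0 1 + Real.cos θ • EuclideanSpace.single 1 1

lemma hasDerivAt_polarDir (θ : ℝ) : HasDerivAt polarDir (polarPerp θ) θ :=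
  ((Real.hasDerivAt_cos θ).smul_const _).add ((Real.hasDerivAt_sin θ).smul_const _)

lemma hasDerivAt_polarPerp (θ : ℝ) : HasDerivAt polarPerp (-polarDir θ) θ := by
  refine (((Real.hasDerivAt_sin θ).neg.smul_const _).add
    ((Real.hasDerivAt_cos θ).smul_const _)).congr_deriv ?_
  simp only [polarDir, neg_smul, neg_add]

lemma continuous_polarDir : Continuous polarDir :=
  continuous_iff_continuousAt.2 fun θ => (hasDerivAt_polarDir θ).continuousAt

lemma polarDir_apply_zero (θ : ℝ) : polarDir θ 0 = Real.cos θ := by simp [polarDir]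

lemma polarDir_apply_one (θ : ℝ) : polarDir θ 1 = Real.sin θ := by simp [polarDir]

lemma norm_polarDir (θ : ℝ) : ‖polarDir θ‖ = 1 := by
  rw [EuclideanSpace.norm_eq, Fin.sum_univ_two, polarDir_apply_zero, polarDir_apply_one]
  simp

lemma norm_smul_polarDir (r θ : ℝ) : ‖r • polarDir θ‖ = |r| := by
  rw [norm_smul, norm_polarDir, mul_one, Real.norm_eq_abs]

lemma polarDir_zero : polarDir 0 = EuclideanSpace.single 0 1 := by simp [polarDir]

lemma smul_polarDir_zero (r : ℝ) : r • polarDir 0 = EuclideanSpace.single 0 r := by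
  rw [polarDir_zero]
  ext i
  fin_cases i <;> simp

lemma polarDir_two_pi : polarDir (2 * Real.pi) = polarDir 0 := by simp [polarDir]

lemma polarPerp_two_pi : polarPerp (2 * Real.pi) = polarPerp 0 := by simp [polarPerp]

lemma exists_eq_smul_polarDir (x : Plane) : ∃ θ, x = ‖x‖ • polarDir θ := by
  have h := Complex.norm_mul_cos_add_sin_mul_I (⟨x 0, x 1⟩ : ℂ)
  have hn : ‖(⟨x 0, x 1⟩ : ℂ)‖ = ‖x‖ := by
    rw [EuclideanSpace.norm_eq, Fin.sum_univ_two, Complex.norm_def, Complex.normSq_mk]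
    simp [sq]
  set z : ℂ := ⟨x 0, x 1⟩ with hz
  refine ⟨z.arg, ?_⟩
  have h0 := Complex.norm_mul_cos_arg z
  have h1 := Complex.norm_mul_sin_arg z
  rw [hn] at h0 h1
  ext i
  fin_cases i
  · simp only [Fin.zero_eta, PiLp.smul_apply, polarDir_apply_zero, smul_eq_mul]
    exact h0.symm
  · simp only [Fin.mk_one, PiLp.smul_apply, polarDir_apply_one, smul_eq_mul]
    exact h1.symm

lemma hasFDerivAt_of_contDiff_two {φ : Plane → ℝ} (hφ : ContDiff ℝ 2 φ) (x : Plane) :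
    HasFDerivAt φ (fderiv ℝ φ x) x :=
  (hφ.differentiable (by norm_num) x).hasFDerivAt

lemma contDiff_one_fderiv {φ : Plane → ℝ} (hφ : ContDiff ℝ 2 φ) : ContDiff ℝ 1 (fderiv ℝ φ) :=
  hφ.fderiv_right (by norm_num)

lemma hasFDerivAt_fderiv {φ : Plane → ℝ} (hφ : ContDiff ℝ 2 φ) (x : Plane) :
    HasFDerivAt (fderiv ℝ φ) (fderiv ℝ (fderiv ℝ φ) x) x :=
  ((contDiff_one_fderiv hφ).differentiable (by norm_num) x).hasFDerivAt

lemma continuous_fderiv_fderiv {φ : Plane → ℝ} (hφ : ContDiff ℝ 2 φ) :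
    Continuous (fderiv ℝ (fderiv ℝ φ)) :=
  (contDiff_one_fderiv hφ).continuous_fderiv (by norm_num)

lemma hasDerivAt_radial {φ : Plane → ℝ} (hφ : ContDiff ℝ 2 φ) (θ r : ℝ) :
    HasDerivAt (fun r : ℝ => φ (r • polarDir θ))
      (fderiv ℝ φ (r • polarDir θ) (polarDir θ)) r := by
  have h : HasDerivAt (fun r : ℝ => r • polarDir θ) (polarDir θ) r := by
    simpa using (hasDerivAt_id r).smul_const (polarDir θ)
  exact (hasFDerivAt_of_contDiff_two hφ _).comp_hasDerivAt r h

lemma hasDerivAt_radial_radial {φ : Plane → ℝ} (hφ : ContDiff ℝ 2 φ) (θ r : ℝ) :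
    HasDerivAt (fun r : ℝ => fderiv ℝ φ (r • polarDir θ) (polarDir θ))
      (fderiv ℝ (fderiv ℝ φ) (r • polarDir θ) (polarDir θ) (polarDir θ)) r := by
  have h : HasDerivAt (fun r : ℝ => r • polarDir θ) (polarDir θ) r := by
    simpa using (hasDerivAt_id r).smul_const (polarDir θ)
  have h2 := (hasFDerivAt_fderiv hφ _).comp_hasDerivAt r h
  simpa using h2.clm_apply (hasDerivAt_const r (polarDir θ))

lemma hasDerivAt_angular {φ : Plane → ℝ} (hφ : ContDiff ℝ 2 φ) (r θ : ℝ) :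
    HasDerivAt (fun θ : ℝ => φ (r • polarDir θ))
      (fderiv ℝ φ (r • polarDir θ) (r • polarPerp θ)) θ := by
  have h : HasDerivAt (fun θ : ℝ => r • polarDir θ) (r • polarPerp θ) θ :=
    (hasDerivAt_polarDir θ).const_smul r
  exact (hasFDerivAt_of_contDiff_two hφ _).comp_hasDerivAt θ h

lemma hasDerivAt_angular_angular {φ : Plane → ℝ} (hφ : ContDiff ℝ 2 φ) (r θ : ℝ) :
    HasDerivAt (fun θ : ℝ => fderiv ℝ φ (r • polarDir θ) (r • polarPerp θ))
      (r ^ 2 * fderiv ℝ (fderiv ℝ φ) (r • polarDir θ) (polarPerp θ) (polarPerp θ)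
        - r * fderiv ℝ φ (r • polarDir θ) (polarDir θ)) θ := by
  have h : HasDerivAt (fun θ : ℝ => r • polarDir θ) (r • polarPerp θ) θ :=
    (hasDerivAt_polarDir θ).const_smul r
  have h' : HasDerivAt (fun θ : ℝ => r • polarPerp θ) (r • -polarDir θ) θ :=
    (hasDerivAt_polarPerp θ).const_smul r
  have h2 := (hasFDerivAt_fderiv hφ _).comp_hasDerivAt θ h
  refine (h2.clm_apply h').congr_deriv ?_
  simp only [Function.comp_apply, map_smul, smul_eq_mul, map_neg, smul_apply]
  ring

/-- The Laplacian in the orthonormal frame of polar coordinates. -/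
lemma laplacian_eq_polar (φ : Plane → ℝ) (x : Plane) (θ : ℝ) :
    (Δ φ) x = fderiv ℝ (fderiv ℝ φ) x (polarDir θ) (polarDir θ)
      + fderiv ℝ (fderiv ℝ φ) x (polarPerp θ) (polarPerp θ) := by
  rw [InnerProductSpace.laplacian_eq_iteratedFDeriv_orthonormalBasis φ
    (EuclideanSpace.basisFun (Fin 2) ℝ)]
  simp only [Fin.sum_univ_two, iteratedFDeriv_two_apply, EuclideanSpace.basisFun_apply, polarDir,
    polarPerp, map_add, map_smul, add_apply, smul_apply,
    smul_eq_mul, Matrix.cons_val_zero, Matrix.cons_val_one]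
  linear_combination -(fderiv ℝ (fderiv ℝ φ) x (EuclideanSpace.single 0 1)
    (EuclideanSpace.single 0 1) + fderiv ℝ (fderiv ℝ φ) x (EuclideanSpace.single 1 1)
    (EuclideanSpace.single 1 1)) * Real.sin_sq_add_cos_sq θ

/-- Differentiation under the integral sign over a compact interval, for a jointly continuous
derivative. -/
lemma hasDerivAt_integral_of_continuous {G G' : ℝ → ℝ → ℝ} (a b : ℝ)
    (hGc : ∀ r, Continuous (G r)) (hG'c : Continuous (Function.uncurry G'))
    (hG : ∀ r θ, HasDerivAt (fun r => G r θ) (G' r θ) r) (r : ℝ) :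
    HasDerivAt (fun r => ∫ θ in a..b, G r θ) (∫ θ in a..b, G' r θ) r := by
  obtain ⟨C, hC⟩ := ((isCompact_Icc (a := r - 1) (b := r + 1)).prod
    (isCompact_uIcc (a := a) (b := b))).exists_bound_of_continuousOn hG'c.continuousOn
  refine (intervalIntegral.hasDerivAt_integral_of_dominated_loc_of_deriv_le (bound := fun _ => C)
    (Icc_mem_nhds (sub_one_lt r) (lt_add_one r))
    (Filter.Eventually.of_forall fun s => (hGc s).aestronglyMeasurable)
    ((hGc r).intervalIntegrable _ _)
    (hG'c.comp (Continuous.prodMk_right r)).aestronglyMeasurable ?_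
    intervalIntegrable_const ?_).2
  · exact Filter.Eventually.of_forall fun θ hθ s hs =>
      hC (s, θ) ⟨hs, Set.uIoc_subset_uIcc hθ⟩
  · exact Filter.Eventually.of_forall fun θ _ s _ => hG s θ

/-- `κ` is an angular mode of frequency `k`: a solution of `κ'' = -k² κ` which is `2π`-periodic
together with its derivative `κ'`, normalized by `|κ| ≤ 1`. -/
structure IsAngularMode (k : ℝ) (κ κ' : ℝ → ℝ) : Prop where
  hasDerivAt : ∀ θ, HasDerivAt κ (κ' θ) θ
  hasDerivAt' : ∀ θ, HasDerivAt κ' (-(k ^ 2 * κ θ)) θ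
  periodic : κ (2 * Real.pi) = κ 0
  periodic' : κ' (2 * Real.pi) = κ' 0
  abs_le_one : ∀ θ, |κ θ| ≤ 1

lemma isAngularMode_cos (k : ℕ) :
    IsAngularMode k (fun θ => Real.cos (k * θ)) (fun θ => -(k * Real.sin (k * θ))) where
  hasDerivAt θ := by
    refine (((hasDerivAt_id θ).const_mul (k : ℝ)).cos).congr_deriv ?_
    simp only [id]; ring
  hasDerivAt' θ := by
    refine ((((hasDerivAt_id θ).const_mul (k : ℝ)).sin).const_mul (k : ℝ)).neg.congr_deriv ?_
    simp only [id]; ring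
  periodic := by simp [Real.cos_nat_mul_two_pi]
  periodic' := by
    have : Real.sin (k * (2 * Real.pi)) = 0 := by
      simpa using Real.sin_add_nat_mul_two_pi 0 k
    simp [this]
  abs_le_one θ := Real.abs_cos_le_one _

lemma isAngularMode_sin (k : ℕ) :
    IsAngularMode k (fun θ => Real.sin (k * θ)) (fun θ => k * Real.cos (k * θ)) where
  hasDerivAt θ := by
    refine (((hasDerivAt_id θ).const_mul (k : ℝ)).sin).congr_deriv ?_
    simp only [id]; ring
  hasDerivAt' θ := by
    refine ((((hasDerivAt_id θ).const_mul (k : ℝ)).cos).const_mul (k : ℝ)).congr_deriv ?_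
    simp only [id]; ring
  periodic := by
    have : Real.sin (k * (2 * Real.pi)) = 0 := by
      simpa using Real.sin_add_nat_mul_two_pi 0 k
    simp [this]
  periodic' := by simp [Real.cos_nat_mul_two_pi]
  abs_le_one θ := Real.abs_sin_le_one _

lemma IsAngularMode.continuous {k : ℝ} {κ κ' : ℝ → ℝ} (hκ : IsAngularMode k κ κ') :
    Continuous κ :=
  continuous_iff_continuousAt.2 fun θ => (hκ.hasDerivAt θ).continuousAt

lemma IsAngularMode.continuous' {k : ℝ} {κ κ' : ℝ → ℝ} (hκ : IsAngularMode k κ κ') :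
    Continuous κ' :=
  continuous_iff_continuousAt.2 fun θ => (hκ.hasDerivAt' θ).continuousAt

/-- The Fourier coefficient `∫ φ(r cos θ, r sin θ) κ(θ) dθ` of `φ` on the circle of radius `r`. -/
noncomputable def circleMode (φ : Plane → ℝ) (κ : ℝ → ℝ) (r : ℝ) : ℝ :=
  ∫ θ in (0 : ℝ)..2 * Real.pi, φ (r • polarDir θ) * κ θ

/-- The derivative of `circleMode φ κ`, as an integral of the radial derivative of `φ`. -/
noncomputable def circleModeDeriv (φ : Plane → ℝ) (κ : ℝ → ℝ) (r : ℝ) : ℝ :=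
  ∫ θ in (0 : ℝ)..2 * Real.pi, fderiv ℝ φ (r • polarDir θ) (polarDir θ) * κ θ

/-- The second derivative of `circleMode φ κ`, as an integral of the second radial derivative of
`φ`. -/
noncomputable def circleModeDerivTwo (φ : Plane → ℝ) (κ : ℝ → ℝ) (r : ℝ) : ℝ :=
  ∫ θ in (0 : ℝ)..2 * Real.pi,
    fderiv ℝ (fderiv ℝ φ) (r • polarDir θ) (polarDir θ) (polarDir θ) * κ θ

lemma hasDerivAt_circleMode {φ : Plane → ℝ} (hφ : ContDiff ℝ 2 φ)
    {k : ℝ} {κ κ' : ℝ → ℝ} (hκ : IsAngularMode k κ κ') (r : ℝ) :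
    HasDerivAt (circleMode φ κ) (circleModeDeriv φ κ r) r := by
  have hd := continuous_polarDir
  have hc := hκ.continuous
  have h0 := hφ.continuous
  have h1 := (contDiff_one_fderiv hφ).continuous
  refine hasDerivAt_integral_of_continuous (G := fun r θ => φ (r • polarDir θ) * κ θ)
    (G' := fun r θ => fderiv ℝ φ (r • polarDir θ) (polarDir θ) * κ θ) _ _ ?_ ?_ ?_ r
  · intro r; fun_prop
  · simp only [Function.uncurry_def]; fun_prop
  · exact fun r θ => (hasDerivAt_radial hφ θ r).mul_const _

lemma hasDerivAt_circleModeDeriv {φ : Plane → ℝ} (hφ : ContDiff ℝ 2 φ)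
    {k : ℝ} {κ κ' : ℝ → ℝ} (hκ : IsAngularMode k κ κ') (r : ℝ) :
    HasDerivAt (circleModeDeriv φ κ) (circleModeDerivTwo φ κ r) r := by
  have hd := continuous_polarDir
  have hc := hκ.continuous
  have h1 := (contDiff_one_fderiv hφ).continuous
  have h2 := continuous_fderiv_fderiv hφ
  refine hasDerivAt_integral_of_continuous
    (G := fun r θ => fderiv ℝ φ (r • polarDir θ) (polarDir θ) * κ θ)
    (G' := fun r θ => fderiv ℝ (fderiv ℝ φ) (r • polarDir θ) (polarDir θ) (polarDir θ) * κ θ)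
    _ _ ?_ ?_ ?_ r
  · intro r; fun_prop
  · simp only [Function.uncurry_def]; fun_prop
  · exact fun r θ => (hasDerivAt_radial_radial hφ θ r).mul_const _

/-- The radial part of the Laplacian of a Fourier mode: the angular derivatives are moved onto `κ`
by two integrations by parts. -/
lemma circleMode_laplacian {φ : Plane → ℝ} (hφ : ContDiff ℝ 2 φ)
    {k : ℝ} {κ κ' : ℝ → ℝ} (hκ : IsAngularMode k κ κ') (r : ℝ) :
    r ^ 2 * circleModeDerivTwo φ κ r + r * circleModeDeriv φ κ r - k ^ 2 * circleMode φ κ r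
      = r ^ 2 * ∫ θ in (0 : ℝ)..2 * Real.pi, (Δ φ) (r • polarDir θ) * κ θ := by
  have hd := continuous_polarDir
  have hp : Continuous polarPerp :=
    continuous_iff_continuousAt.2 fun θ => (hasDerivAt_polarPerp θ).continuousAt
  have hc := hκ.continuous
  have hc' := hκ.continuous'
  have h0 := hφ.continuous
  have h1 := (contDiff_one_fderiv hφ).continuous
  have h2 := continuous_fderiv_fderiv hφ
  -- the derivative of `A κ - φ κ'` contains both integrations by parts
  set A : ℝ → ℝ := fun θ => fderiv ℝ φ (r • polarDir θ) (r • polarPerp θ) with hA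
  have hAd := hasDerivAt_angular_angular hφ r
  have hW : ∀ θ, HasDerivAt (fun θ => A θ * κ θ - φ (r • polarDir θ) * κ' θ)
      ((r ^ 2 * fderiv ℝ (fderiv ℝ φ) (r • polarDir θ) (polarPerp θ) (polarPerp θ)
        - r * fderiv ℝ φ (r • polarDir θ) (polarDir θ)) * κ θ
        + k ^ 2 * (φ (r • polarDir θ) * κ θ)) θ := by
    intro θ
    refine (((hAd θ).mul (hκ.hasDerivAt θ)).sub
      ((hasDerivAt_angular hφ r θ).mul (hκ.hasDerivAt' θ))).congr_deriv ?_
    ring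
  have hint := intervalIntegral.integral_eq_sub_of_hasDerivAt (a := 0) (b := 2 * Real.pi)
    (fun θ _ => hW θ) (Continuous.intervalIntegrable (by fun_prop) _ _)
  simp only [hA, hκ.periodic, hκ.periodic', polarDir_two_pi, polarPerp_two_pi, sub_self] at hint
  have hΔ : ∫ θ in (0 : ℝ)..2 * Real.pi, (Δ φ) (r • polarDir θ) * κ θ
      = ∫ θ in (0 : ℝ)..2 * Real.pi,
        (fderiv ℝ (fderiv ℝ φ) (r • polarDir θ) (polarDir θ) (polarDir θ)
          + fderiv ℝ (fderiv ℝ φ) (r • polarDir θ) (polarPerp θ) (polarPerp θ)) * κ θ :=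
    intervalIntegral.integral_congr fun θ _ => by rw [laplacian_eq_polar φ _ θ]
  simp only [circleModeDerivTwo, circleModeDeriv, circleMode]
  rw [hΔ, ← intervalIntegral.integral_const_mul, ← intervalIntegral.integral_const_mul,
    ← intervalIntegral.integral_const_mul, ← intervalIntegral.integral_const_mul,
    ← intervalIntegral.integral_add (Continuous.intervalIntegrable (by fun_prop) _ _)
      (Continuous.intervalIntegrable (by fun_prop) _ _),
    ← intervalIntegral.integral_sub (Continuous.intervalIntegrable (by fun_prop) _ _)
      (Continuous.intervalIntegrable (by fun_prop) _ _), ← sub_eq_zero,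
    ← intervalIntegral.integral_sub (Continuous.intervalIntegrable (by fun_prop) _ _)
      (Continuous.intervalIntegrable (by fun_prop) _ _), ← neg_eq_zero,
    ← intervalIntegral.integral_neg]
  refine Eq.trans ?_ hint
  exact intervalIntegral.integral_congr fun θ _ => by ring

lemma abs_circleMode_le {φ : Plane → ℝ} {k : ℝ} {κ κ' : ℝ → ℝ}
    (hκ : IsAngularMode k κ κ') {r B : ℝ} (hB : ∀ θ, |φ (r • polarDir θ)| ≤ B) :
    |circleMode φ κ r| ≤ 2 * Real.pi * B := by
  have := intervalIntegral.norm_integral_le_of_norm_le_const (a := 0) (b := 2 * Real.pi)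
    (f := fun θ => φ (r • polarDir θ) * κ θ) (C := B) fun θ _ => by
      rw [norm_mul]
      calc ‖φ (r • polarDir θ)‖ * ‖κ θ‖ ≤ B * 1 :=
            mul_le_mul (hB θ) (hκ.abs_le_one θ) (norm_nonneg _) ((abs_nonneg _).trans (hB θ))
        _ = B := mul_one B
  rw [sub_zero, abs_of_pos Real.two_pi_pos] at this
  rw [mul_comm]
  exact this

/-- A continuous `2π`-periodic function with vanishing Fourier coefficients vanishes. -/
lemma eq_zero_of_fourier_integrals_eq_zero {ψ : ℝ → ℝ} (hψ : Continuous ψ)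
    (hper : Function.Periodic ψ (2 * Real.pi))
    (hcos : ∀ k : ℕ, ∫ θ in (0 : ℝ)..2 * Real.pi, ψ θ * Real.cos (k * θ) = 0)
    (hsin : ∀ k : ℕ, ∫ θ in (0 : ℝ)..2 * Real.pi, ψ θ * Real.sin (k * θ) = 0) (θ : ℝ) :
    ψ θ = 0 := by
  have : Fact (0 < 2 * Real.pi) := ⟨Real.two_pi_pos⟩
  have hperC : Function.Periodic (fun θ => (ψ θ : ℂ)) (2 * Real.pi) := fun θ => by
    simp only [hper θ]
  set F : C(AddCircle (2 * Real.pi), ℂ) :=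
    ⟨hperC.lift, continuous_quot_lift _ (Complex.continuous_ofReal.comp hψ)⟩ with hF
  have hFcoe : ∀ x : ℝ, F x = ψ x := fun x => hperC.lift_coe x
  have hcosZ : ∀ n : ℤ, ∫ θ in (0 : ℝ)..2 * Real.pi, ψ θ * Real.cos (n * θ) = 0 := by
    intro n
    obtain ⟨k, rfl | rfl⟩ := n.eq_nat_or_neg
    · simpa using hcos k
    · simpa [neg_mul, Real.cos_neg] using hcos k
  have hsinZ : ∀ n : ℤ, ∫ θ in (0 : ℝ)..2 * Real.pi, ψ θ * Real.sin (n * θ) = 0 := by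
    intro n
    obtain ⟨k, rfl | rfl⟩ := n.eq_nat_or_neg
    · simpa using hsin k
    · simpa [neg_mul, Real.sin_neg] using hsin k
  have hcoeff : fourierCoeff F = 0 := by
    funext n
    rw [fourierCoeff_eq_intervalIntegral F n 0, zero_add, Pi.zero_apply]
    have : ∫ x in (0 : ℝ)..2 * Real.pi, fourier (-n) (x : AddCircle (2 * Real.pi)) • F x
        = ∫ x in (0 : ℝ)..2 * Real.pi, (((ψ x * Real.cos (n * x) : ℝ) : ℂ)
          + (-Complex.I) * ((ψ x * Real.sin (n * x) : ℝ) : ℂ)) := by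
      refine intervalIntegral.integral_congr fun x _ => ?_
      have h1 : 2 * (Real.pi : ℂ) * Complex.I * ((-n : ℤ) : ℂ) * x / ((2 * Real.pi : ℝ) : ℂ)
          = ((-(n * x) : ℝ) : ℂ) * Complex.I := by
        have : (Real.pi : ℂ) ≠ 0 := Complex.ofReal_ne_zero.2 Real.pi_ne_zero
        push_cast
        field_simp
      simp only [fourier_coe_apply]
      rw [h1, Complex.exp_mul_I, hFcoe, ← Complex.ofReal_cos, ← Complex.ofReal_sin, Real.cos_neg,
        Real.sin_neg, smul_eq_mul]
      push_cast
      ring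
    rw [this, intervalIntegral.integral_add, intervalIntegral.integral_const_mul,
      intervalIntegral.integral_ofReal, intervalIntegral.integral_ofReal, hcosZ, hsinZ]
    · simp
    · exact Continuous.intervalIntegrable (by fun_prop) _ _
    · exact Continuous.intervalIntegrable (by fun_prop) _ _
  have hs := has_pointwise_sum_fourier_series_of_summable (f := F)
    (by rw [hcoeff]; exact summable_zero) (θ : AddCircle (2 * Real.pi))
  simp only [hcoeff, Pi.zero_apply, zero_smul] at hs
  have h0 := hs.unique hasSum_zero
  rw [hFcoe] at h0
  exact_mod_cast h0

/-! ### The ordinary differential equations of the Fourier modes -/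

/-- The profile of a radial function, as an even function of a radius of either sign. -/
noncomputable def radialProfile (f : Plane → ℝ) (r : ℝ) : ℝ := f (EuclideanSpace.single 0 r)

/-- `f` solves the linearized equations of frequency `k` about the radial profiles `U`,
`fᵢ'' + fᵢ' / r - k² fᵢ / r² + ∑ⱼ aᵢⱼ e^{Uⱼ} fⱼ = 0`, and is regular at the origin. The equations
are multiplied by `r²`, so that they make sense at `r = 0`. -/
structure IsModeSolution {n : ℕ} (A : Matrix (Fin n) (Fin n) ℝ) (U : Fin n → ℝ → ℝ) (k : ℝ)
    (f f' f'' : Fin n → ℝ → ℝ) : Prop where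
  hasDerivAt : ∀ i r, HasDerivAt (f i) (f' i r) r
  hasDerivAt' : ∀ i r, HasDerivAt (f' i) (f'' i r) r
  continuous'' : ∀ i, Continuous (f'' i)
  equation : ∀ i r, r ^ 2 * f'' i r + r * f' i r - k ^ 2 * f i r
    = -(r ^ 2 * ∑ j, A i j * Real.exp (U j r) * f j r)

/-- `U`, with derivative `U'`, is the profile of a radial finite energy solution of the Liouville
system. -/
structure IsLiouvilleProfile {n : ℕ} (A : Matrix (Fin n) (Fin n) ℝ) (U U' : Fin n → ℝ → ℝ) :
    Prop where
  hasDerivAt : ∀ i r, HasDerivAt (U i) (U' i r) r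
  continuous' : ∀ i, Continuous (U' i)
  hasDerivAt' : ∀ i r, 0 < r →
    HasDerivAt (U' i) (-(U' i r / r) - ∑ j, A i j * Real.exp (U j r)) r
  energy : ∀ i, IntegrableOn (fun r => r * Real.exp (U i r)) (Set.Ioi 0)

lemma IsRadial.apply_smul_polarDir {f : Plane → ℝ} (hf : IsRadial f) (r θ : ℝ) :
    f (r • polarDir θ) = radialProfile f r := by
  refine hf _ _ ?_
  rw [← smul_polarDir_zero, norm_smul_polarDir, norm_smul_polarDir]

lemma radialDeriv_eq {f : Plane → ℝ} (hf : ContDiff ℝ 2 f) (r : ℝ) :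
    radialDeriv f r = fderiv ℝ f (r • polarDir 0) (polarDir 0) := by
  have := (hasDerivAt_radial hf 0 r).deriv
  simp only [smul_polarDir_zero] at this ⊢
  exact this

/-- The restriction of a radial solution to a ray: the second angular derivative vanishes, which
turns the Laplacian into an ordinary differential operator. -/
lemma IsRadial.isLiouvilleProfile {n : ℕ} {A : Matrix (Fin n) (Fin n) ℝ} {u : Fin n → Plane → ℝ}
    (hu : IsLiouvilleSolution A u) (hrad : ∀ i, IsRadial (u i)) :
    IsLiouvilleProfile A (fun i => radialProfile (u i)) (fun i => radialDeriv (u i)) where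
  hasDerivAt i r := by
    have := hasDerivAt_radial (hu.contDiff i) 0 r
    rw [← radialDeriv_eq (hu.contDiff i)] at this
    simp only [smul_polarDir_zero] at this
    exact this
  continuous' i := by
    have h1 := (contDiff_one_fderiv (hu.contDiff i)).continuous
    have : radialDeriv (u i) = fun r => fderiv ℝ (u i) (r • polarDir 0) (polarDir 0) :=
      funext fun r => radialDeriv_eq (hu.contDiff i) r
    rw [this]
    fun_prop
  hasDerivAt' i r hr := by
    have h1 := hasDerivAt_radial_radial (hu.contDiff i) 0 r
    simp only [← radialDeriv_eq (hu.contDiff i)] at h1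
    refine h1.congr_deriv ?_
    have h2 : ∀ θ, fderiv ℝ (u i) (r • polarDir θ) (r • polarPerp θ) = 0 := by
      intro θ
      have h3 : (fun θ : ℝ => u i (r • polarDir θ)) = fun _ => radialProfile (u i) r :=
        funext fun θ => (hrad i).apply_smul_polarDir r θ
      have h4 := hasDerivAt_angular (hu.contDiff i) r θ
      rw [h3] at h4
      exact h4.unique (hasDerivAt_const θ _)
    have h5 := hasDerivAt_angular_angular (hu.contDiff i) r 0
    simp only [h2] at h5
    have h6 := h5.unique (hasDerivAt_const (0 : ℝ) (0 : ℝ))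
    have h7 := hu.equation i (r • polarDir 0)
    rw [laplacian_eq_polar _ _ 0] at h7
    rw [← radialDeriv_eq (hu.contDiff i)] at h6
    simp only [(hrad _).apply_smul_polarDir] at h7
    have h8 : fderiv ℝ (fderiv ℝ (u i)) (r • polarDir 0) (polarPerp 0) (polarPerp 0)
        = radialDeriv (u i) r / r := by
      rw [eq_div_iff hr.ne']
      have : r * (fderiv ℝ (fderiv ℝ (u i)) (r • polarDir 0) (polarPerp 0) (polarPerp 0) * r
        - radialDeriv (u i) r) = 0 := by linear_combination h6
      linarith [(mul_eq_zero.1 this).resolve_left hr.ne']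
    linarith
  energy i := by
    have h := hu.energy i
    have heq : (fun x : Plane => Real.exp (u i x))
        = fun x => (fun r => Real.exp (radialProfile (u i) r)) ‖x‖ := by
      funext x
      have : u i x = radialProfile (u i) ‖x‖ := hrad i _ _ (by simp)
      rw [this]
    rw [heq, integrable_fun_norm_addHaar volume (f := fun r => Real.exp (radialProfile (u i) r))]
      at h
    simpa using h

/-- The Fourier modes of a solution of the linearized system decouple, because the coefficients
`e^{uⱼ}` are radial. -/
lemma IsLinearizedSolution.isModeSolution {n : ℕ} {A : Matrix (Fin n) (Fin n) ℝ}
    {u φ : Fin n → Plane → ℝ} (hrad : ∀ i, IsRadial (u i))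
    (hφ : IsLinearizedSolution A u φ) {k : ℝ} {κ κ' : ℝ → ℝ} (hκ : IsAngularMode k κ κ') :
    IsModeSolution A (fun i => radialProfile (u i)) k (fun i => circleMode (φ i) κ)
      (fun i => circleModeDeriv (φ i) κ) (fun i => circleModeDerivTwo (φ i) κ) where
  hasDerivAt i r := hasDerivAt_circleMode (hφ.contDiff i) hκ r
  hasDerivAt' i r := hasDerivAt_circleModeDeriv (hφ.contDiff i) hκ r
  continuous'' i := by
    have hd := continuous_polarDir
    have hc := hκ.continuous
    have h2 := continuous_fderiv_fderiv (hφ.contDiff i)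
    refine intervalIntegral.continuous_parametric_intervalIntegral_of_continuous'
      (f := fun r θ => fderiv ℝ (fderiv ℝ (φ i)) (r • polarDir θ) (polarDir θ) (polarDir θ) * κ θ)
      ?_ _ _
    simp only [Function.uncurry_def]
    fun_prop
  equation i r := by
    have hd := continuous_polarDir
    have hc := hκ.continuous
    have h0 := fun j => (hφ.contDiff j).continuous
    rw [circleMode_laplacian (hφ.contDiff i) hκ r, ← mul_neg]
    congr 1
    have : ∀ θ, (Δ (φ i)) (r • polarDir θ) * κ θ
        = -∑ j, A i j * Real.exp (radialProfile (u j) r) * (φ j (r • polarDir θ) * κ θ) := by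
      intro θ
      have h := hφ.equation i (r • polarDir θ)
      simp only [(hrad _).apply_smul_polarDir] at h
      have h' : (Δ (φ i)) (r • polarDir θ)
          = -∑ j, A i j * Real.exp (radialProfile (u j) r) * φ j (r • polarDir θ) := by
        rw [← h]; exact (neg_neg _).symm
      rw [h', neg_mul, Finset.sum_mul]
      simp only [mul_assoc]
    simp only [this, circleMode]
    rw [intervalIntegral.integral_neg, intervalIntegral.integral_finsetSum]
    · simp only [intervalIntegral.integral_const_mul]
    · intro j _
      have := h0 j
      exact Continuous.intervalIntegrable (by fun_prop) _ _

lemma IsAngularMode.integral_mul_eq_zero {k l : ℝ} {κ κ' μ μ' : ℝ → ℝ} (hκ : IsAngularMode k κ κ')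
    (hμ : IsAngularMode l μ μ') (hkl : k ^ 2 ≠ l ^ 2) :
    ∫ θ in (0 : ℝ)..2 * Real.pi, κ θ * μ θ = 0 := by
  have hκc := hκ.continuous
  have hμc := hμ.continuous
  have hW : ∀ θ, HasDerivAt (fun θ => κ' θ * μ θ - κ θ * μ' θ)
      ((l ^ 2 - k ^ 2) * (κ θ * μ θ)) θ := fun θ =>
    (((hκ.hasDerivAt' θ).mul (hμ.hasDerivAt θ)).sub
      ((hκ.hasDerivAt θ).mul (hμ.hasDerivAt' θ))).congr_deriv (by ring)
  have h := intervalIntegral.integral_eq_sub_of_hasDerivAt (a := 0) (b := 2 * Real.pi)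
    (fun θ _ => hW θ) (Continuous.intervalIntegrable (by fun_prop) _ _)
  rw [intervalIntegral.integral_const_mul, hκ.periodic, hκ.periodic', hμ.periodic, hμ.periodic',
    sub_self] at h
  exact (mul_eq_zero.1 h).resolve_left (sub_ne_zero.2 hkl.symm)

/-- A function all of whose modes of frequency at least `2` vanish on a circle is, on this circle,
a combination of `1`, `cos θ` and `sin θ`. -/
lemma eq_of_circleMode_eq_zero {φ : Plane → ℝ} (hφ : Continuous φ) (r : ℝ)
    (hcos : ∀ k : ℕ, 2 ≤ k → circleMode φ (fun θ => Real.cos (k * θ)) r = 0)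
    (hsin : ∀ k : ℕ, 2 ≤ k → circleMode φ (fun θ => Real.sin (k * θ)) r = 0) (θ : ℝ) :
    φ (r • polarDir θ) = (2 * Real.pi)⁻¹ * circleMode φ (fun θ => Real.cos ((0 : ℕ) * θ)) r
      + Real.pi⁻¹ * (circleMode φ (fun θ => Real.cos ((1 : ℕ) * θ)) r * Real.cos θ
        + circleMode φ (fun θ => Real.sin ((1 : ℕ) * θ)) r * Real.sin θ) := by
  set a := (2 * Real.pi)⁻¹ * circleMode φ (fun θ => Real.cos ((0 : ℕ) * θ)) r with ha
  set b := Real.pi⁻¹ * circleMode φ (fun θ => Real.cos ((1 : ℕ) * θ)) r with hb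
  set c := Real.pi⁻¹ * circleMode φ (fun θ => Real.sin ((1 : ℕ) * θ)) r with hc
  have hd := continuous_polarDir
  have horth : ∀ κ : ℝ → ℝ, Continuous κ →
      ∫ θ in (0 : ℝ)..2 * Real.pi,
        (φ (r • polarDir θ) - a - b * Real.cos θ - c * Real.sin θ) * κ θ
      = circleMode φ κ r - a * (∫ θ in (0 : ℝ)..2 * Real.pi, κ θ)
        - b * (∫ θ in (0 : ℝ)..2 * Real.pi, Real.cos θ * κ θ)
        - c * ∫ θ in (0 : ℝ)..2 * Real.pi, Real.sin θ * κ θ := by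
    intro κ hκ
    rw [circleMode, ← intervalIntegral.integral_const_mul, ← intervalIntegral.integral_const_mul,
      ← intervalIntegral.integral_const_mul,
      ← intervalIntegral.integral_sub (Continuous.intervalIntegrable (by fun_prop) _ _)
        (Continuous.intervalIntegrable (by fun_prop) _ _),
      ← intervalIntegral.integral_sub (Continuous.intervalIntegrable (by fun_prop) _ _)
        (Continuous.intervalIntegrable (by fun_prop) _ _),
      ← intervalIntegral.integral_sub (Continuous.intervalIntegrable (by fun_prop) _ _)
        (Continuous.intervalIntegrable (by fun_prop) _ _)]
    exact intervalIntegral.integral_congr fun θ _ => by ring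
  have hzero : ∀ (k : ℕ) (κ κ' : ℝ → ℝ), 2 ≤ k → IsAngularMode k κ κ' → circleMode φ κ r = 0 →
      ∫ θ in (0 : ℝ)..2 * Real.pi,
        (φ (r • polarDir θ) - a - b * Real.cos θ - c * Real.sin θ) * κ θ = 0 := by
    intro k κ κ' hk hκ h0
    have hk' : (2 : ℝ) ≤ k := by exact_mod_cast hk
    have h1 := (isAngularMode_cos 0).integral_mul_eq_zero hκ (by
      rw [Nat.cast_zero]; nlinarith)
    have h2 := (isAngularMode_cos 1).integral_mul_eq_zero hκ (by
      rw [Nat.cast_one]; nlinarith)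
    have h3 := (isAngularMode_sin 1).integral_mul_eq_zero hκ (by
      rw [Nat.cast_one]; nlinarith)
    simp only [Nat.cast_zero, Nat.cast_one, zero_mul, one_mul, Real.cos_zero] at h1 h2 h3
    rw [horth κ hκ.continuous, h0, h1, h2, h3]
    ring
  have hπ := Real.pi_ne_zero
  have hcc : ∫ θ in (0 : ℝ)..2 * Real.pi, Real.cos θ * Real.cos θ = Real.pi := by
    simp only [← sq]; rw [integral_cos_sq]; simp
  have hss : ∫ θ in (0 : ℝ)..2 * Real.pi, Real.sin θ * Real.sin θ = Real.pi := by
    simp only [← sq]; rw [integral_sin_sq]; simp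
  have hsc : ∫ θ in (0 : ℝ)..2 * Real.pi, Real.sin θ * Real.cos θ = 0 := by
    rw [integral_sin_mul_cos₁]; simp
  have hcs : ∫ θ in (0 : ℝ)..2 * Real.pi, Real.cos θ * Real.sin θ = 0 := by
    simp only [mul_comm (Real.cos _)]; exact hsc
  have key := eq_zero_of_fourier_integrals_eq_zero
    (ψ := fun θ => φ (r • polarDir θ) - a - b * Real.cos θ - c * Real.sin θ) (by fun_prop)
    (fun θ => by
      simp only [polarDir, Real.cos_add_two_pi, Real.sin_add_two_pi])
    (fun k => by
      rcases lt_or_ge k 2 with hk | hk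
      · rw [horth _ (by fun_prop)]
        interval_cases k
        · simp [ha]
          field_simp
          ring
        · simp only [Nat.cast_one, one_mul] at hb ⊢
          rw [hcc, hsc, hb]
          simp
          field_simp
          ring
      · exact hzero k _ _ hk (isAngularMode_cos k) (hcos k hk))
    (fun k => by
      rcases lt_or_ge k 2 with hk | hk
      · interval_cases k
        · simp
        · rw [horth _ (by fun_prop)]
          simp only [Nat.cast_one, one_mul] at hc ⊢
          rw [hcs, hss, hc]
          simp
          field_simp
          ring
      · exact hzero k _ _ hk (isAngularMode_sin k) (hsin k hk)) θ
  simp only [hb, hc] at key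
  linear_combination key

/-! ### Radial solutions of the Liouville system -/

lemma IsH1.exists_pos {n : ℕ} {A : Matrix (Fin n) (Fin n) ℝ} (hA : IsH1 A) (i : Fin n) :
    ∃ j, 0 < A i j := by
  by_contra! h
  have h0 : ∀ j, A i j = 0 := fun j => le_antisymm (h j) (hA.nonneg i j)
  have hdet := (Matrix.isUnit_iff_isUnit_det A).1 hA.invertible
  rw [Matrix.det_eq_zero_of_row_eq_zero i h0] at hdet
  exact not_isUnit_zero hdet

lemma IsH1.eq_univ_of_closed {n : ℕ} {A : Matrix (Fin n) (Fin n) ℝ} (hA : IsH1 A)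
    {Z : Set (Fin n)} (hZ : Z.Nonempty) (h : ∀ i ∈ Z, ∀ j, 0 < A i j → j ∈ Z) : Z = Set.univ := by
  obtain ⟨i, hi⟩ := hZ
  refine Set.eq_univ_of_forall fun j => ?_
  let _ := Matrix.toQuiver A
  obtain ⟨p, -⟩ := hA.irreducible.connected i j
  induction p with
  | nil => exact hi
  | cons _ e ih => exact h _ ih _ e.down

/-- The mass `∫₀ʳ s e^{Uᵢ(s)} ds` of the `i`-th component in the disc of radius `r`, up to the
factor `2π`. -/
noncomputable def radialMass {n : ℕ} (U : Fin n → ℝ → ℝ) (i : Fin n) (r : ℝ) : ℝ :=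
  ∫ s in (0 : ℝ)..r, s * Real.exp (U i s)

namespace IsLiouvilleProfile

variable {n : ℕ} {A : Matrix (Fin n) (Fin n) ℝ} {U U' : Fin n → ℝ → ℝ}

lemma continuous (h : IsLiouvilleProfile A U U') (i : Fin n) : Continuous (U i) :=
  continuous_iff_continuousAt.2 fun r => (h.hasDerivAt i r).continuousAt

lemma hasDerivAt_radialMass (h : IsLiouvilleProfile A U U') (i : Fin n) (r : ℝ) :
    HasDerivAt (radialMass U i) (r * Real.exp (U i r)) r := by
  have hc : Continuous fun s => s * Real.exp (U i s) :=
    continuous_id.mul (Real.continuous_exp.comp (h.continuous i))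
  exact intervalIntegral.integral_hasDerivAt_right (hc.intervalIntegrable _ _)
    hc.stronglyMeasurable.stronglyMeasurableAtFilter hc.continuousAt

lemma radialMass_zero (U : Fin n → ℝ → ℝ) (i : Fin n) : radialMass U i 0 = 0 :=
  intervalIntegral.integral_same

lemma strictMonoOn_radialMass (h : IsLiouvilleProfile A U U') (i : Fin n) :
    StrictMonoOn (radialMass U i) (Set.Ici 0) := by
  refine strictMonoOn_of_deriv_pos (convex_Ici 0)
    (fun r _ => (h.hasDerivAt_radialMass i r).continuousAt.continuousWithinAt) fun r hr => ?_
  rw [interior_Ici] at hr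
  rw [(h.hasDerivAt_radialMass i r).deriv]
  exact mul_pos hr (Real.exp_pos _)

lemma radialMass_pos (h : IsLiouvilleProfile A U U') (i : Fin n) {r : ℝ} (hr : 0 < r) :
    0 < radialMass U i r := by
  rw [← radialMass_zero U i]
  exact h.strictMonoOn_radialMass i Set.self_mem_Ici hr.le hr

lemma radialMass_le (h : IsLiouvilleProfile A U U') (i : Fin n) {r : ℝ} (hr : 0 ≤ r) :
    radialMass U i r ≤ ∫ s in Set.Ioi (0 : ℝ), s * Real.exp (U i s) := by
  rw [radialMass, intervalIntegral.integral_of_le hr]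
  refine setIntegral_mono_set (h.energy i) ?_ Set.Ioc_subset_Ioi_self.eventuallyLE
  exact (ae_restrict_mem measurableSet_Ioi).mono fun s hs =>
    mul_nonneg (le_of_lt hs) (Real.exp_pos _).le

/-- The flux identity: the divergence theorem on the disc of radius `r`. -/
lemma mul_deriv_eq (h : IsLiouvilleProfile A U U') (i : Fin n) {r : ℝ} (hr : 0 ≤ r) :
    r * U' i r = -∑ j, A i j * radialMass U j r := by
  set F : ℝ → ℝ := fun r => r * U' i r + ∑ j, A i j * radialMass U j r with hF
  have hFd : ∀ r, 0 < r → HasDerivAt F 0 r := by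
    intro r hr
    refine (((hasDerivAt_id r).mul (h.hasDerivAt' i r hr)).add
      (HasDerivAt.fun_sum fun j _ => (h.hasDerivAt_radialMass j r).const_mul (A i j))).congr_deriv
      ?_
    have : ∑ j, A i j * (r * Real.exp (U j r)) = r * ∑ j, A i j * Real.exp (U j r) := by
      rw [Finset.mul_sum]; exact Finset.sum_congr rfl fun j _ => by ring
    rw [this]
    simp only [id]
    field_simp
    ring
  have hFc : Continuous F := (continuous_id.mul (h.continuous' i)).add
    (continuous_finsetSum _ fun j _ => continuous_const.mul
      (continuous_iff_continuousAt.2 fun r => (h.hasDerivAt_radialMass j r).continuousAt))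
  have h0 : F 0 = 0 := by simp [hF, radialMass_zero]
  rcases hr.eq_or_lt with rfl | hr'
  · simp [radialMass_zero]
  obtain ⟨c, hc, hc'⟩ := exists_hasDerivAt_eq_slope F (fun _ => 0) hr' hFc.continuousOn
    fun s hs => hFd s hs.1
  rw [h0, sub_zero, sub_zero, eq_div_iff hr'.ne', zero_mul] at hc'
  have : F r = 0 := hc'.symm
  simp only [hF] at this
  linarith

lemma deriv_zero (h : IsLiouvilleProfile A U U') (i : Fin n) : U' i 0 = 0 := by
  -- `U'` is continuous, and `U'(r) = -r⁻¹ ∑ⱼ aᵢⱼ ∫₀ʳ s e^{Uⱼ}` where the integral is `o(r)`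
  have h1 : Filter.Tendsto (fun r : ℝ => U' i r) (𝓝[>] 0) (𝓝 (U' i 0)) :=
    ((h.continuous' i).tendsto 0).mono_left nhdsWithin_le_nhds
  have h2 : HasDerivAt (fun r => -∑ j, A i j * radialMass U j r) 0 0 := by
    refine (HasDerivAt.fun_sum (u := Finset.univ) fun j _ =>
      (h.hasDerivAt_radialMass j 0).const_mul (A i j)).neg.congr_deriv ?_
    simp
  have h3 := h2.tendsto_slope_zero_right
  refine tendsto_nhds_unique h1 (h3.congr' ?_)
  filter_upwards [self_mem_nhdsWithin] with r hr
  have hr0 : (0 : ℝ) < r := hr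
  simp only [zero_add, radialMass_zero, mul_zero, Finset.sum_const_zero, neg_zero, sub_zero]
  rw [← h.mul_deriv_eq i hr0.le, smul_eq_mul, inv_mul_cancel_left₀ hr0.ne']

lemma deriv_neg (h : IsLiouvilleProfile A U U') (hA : IsH1 A) (i : Fin n) {r : ℝ} (hr : 0 < r) :
    U' i r < 0 := by
  obtain ⟨j, hj⟩ := hA.exists_pos i
  have h1 : 0 < ∑ j, A i j * radialMass U j r :=
    Finset.sum_pos' (fun k _ => mul_nonneg (hA.nonneg i k) (h.radialMass_pos k hr).le)
      ⟨j, Finset.mem_univ j, mul_pos hj (h.radialMass_pos j hr)⟩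
  have h2 := h.mul_deriv_eq i hr.le
  by_contra! h3
  have := mul_nonneg hr.le h3
  linarith

lemma antitoneOn_mul_deriv (h : IsLiouvilleProfile A U U') (hA : IsH1 A) (i : Fin n) :
    AntitoneOn (fun r => r * U' i r) (Set.Ici 0) := by
  intro r hr s hs hrs
  simp only [h.mul_deriv_eq i hr, h.mul_deriv_eq i hs]
  exact neg_le_neg (Finset.sum_le_sum fun j _ => mul_le_mul_of_nonneg_left
    ((h.strictMonoOn_radialMass j).monotoneOn hr hs hrs) (hA.nonneg i j))

/-- Finite energy forces `r Uᵢ'(r)` below `-2`: otherwise `r e^{Uᵢ}` would dominate a multiple of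
`1 / r`. -/
lemma exists_mul_deriv_lt (h : IsLiouvilleProfile A U U') (i : Fin n) :
    ∃ r, 0 < r ∧ r * U' i r < -2 := by
  by_contra! hcon
  have hmono : MonotoneOn (fun r => U i r + 2 * Real.log r) (Set.Ici 1) := by
    have hd : ∀ r, 0 < r → HasDerivAt (fun r => U i r + 2 * Real.log r) (U' i r + 2 * r⁻¹) r :=
      fun r hr => (h.hasDerivAt i r).add ((Real.hasDerivAt_log hr.ne').const_mul 2)
    refine monotoneOn_of_hasDerivWithinAt_nonneg (convex_Ici 1)
      (fun r hr => (hd r (zero_lt_one.trans_le hr)).continuousAt.continuousWithinAt)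
      (fun r hr => (hd r (zero_lt_one.trans_le (interior_subset hr))).hasDerivWithinAt)
      fun r hr => ?_
    have hr0 : 0 < r := zero_lt_one.trans_le (interior_subset hr)
    have h1 := hcon r hr0
    have h2 : U' i r + 2 * r⁻¹ = (r * U' i r + 2) / r := by field_simp
    rw [h2]
    exact div_nonneg (by linarith) hr0.le
  have hint : IntegrableOn (fun r : ℝ => Real.exp (U i 1) * r⁻¹) (Set.Ioi 1) := by
    refine ((h.energy i).mono_set (Set.Ioi_subset_Ioi zero_le_one)).mono'
      (measurable_inv.const_mul _).aestronglyMeasurable ?_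
    refine (ae_restrict_mem measurableSet_Ioi).mono fun r hr => ?_
    have hr1 : (1 : ℝ) < r := hr
    have hr0 : 0 < r := zero_lt_one.trans hr1
    have h1 := hmono (Set.mem_Ici.2 le_rfl) (Set.mem_Ici.2 hr1.le) hr1.le
    simp only [Real.log_one, mul_zero, add_zero] at h1
    rw [Real.norm_eq_abs, abs_of_pos (mul_pos (Real.exp_pos _) (inv_pos.2 hr0))]
    have h2 : Real.exp (U i 1) ≤ Real.exp (U i r) * r ^ 2 := by
      calc Real.exp (U i 1) ≤ Real.exp (U i r + 2 * Real.log r) := Real.exp_le_exp.2 h1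
        _ = Real.exp (U i r) * r ^ 2 := by
          rw [Real.exp_add, two_mul, Real.exp_add, Real.exp_log hr0, sq]
    rw [← div_eq_mul_inv, div_le_iff₀ hr0]
    nlinarith
  refine not_integrableOn_Ioi_inv (a := 1) ?_
  have := hint.const_mul (Real.exp (U i 1))⁻¹
  refine this.congr (Filter.Eventually.of_forall fun r => ?_)
  simp only
  rw [inv_mul_cancel_left₀ (Real.exp_pos _).ne']

/-- The decay of the profiles at infinity, with a uniform gain `δ` over the critical exponent. -/
lemma exists_decay (h : IsLiouvilleProfile A U U') (hA : IsH1 A) :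
    ∃ δ > 0, ∃ R > 0, ∃ C, 0 ≤ C ∧ ∀ i r, R ≤ r → r * U' i r ≤ -2 - δ ∧
      Real.exp (U i r) ≤ C * r ^ (-2 - δ) := by
  have h1 : ∀ᶠ δ in 𝓝[>] (0 : ℝ), ∀ i, ∀ᶠ r in Filter.atTop, r * U' i r ≤ -2 - δ := by
    rw [Filter.eventually_all]
    intro i
    obtain ⟨s, hs, hs'⟩ := h.exists_mul_deriv_lt i
    filter_upwards [Ioo_mem_nhdsGT (show (0 : ℝ) < -2 - s * U' i s by linarith)] with δ hδ
    filter_upwards [Filter.eventually_ge_atTop s] with r hr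
    have := h.antitoneOn_mul_deriv hA i (Set.mem_Ici.2 hs.le) (Set.mem_Ici.2 (hs.le.trans hr)) hr
    simp only at this
    linarith [hδ.2]
  obtain ⟨δ, hδ, hδpos⟩ := (h1.and self_mem_nhdsWithin).exists
  obtain ⟨R, hR⟩ := Filter.eventually_atTop.1
    ((Filter.eventually_all.2 hδ).and (Filter.eventually_gt_atTop 0))
  have hR0 : 0 < R := (hR R le_rfl).2
  have hanti : ∀ i, AntitoneOn (fun r => U i r + (2 + δ) * Real.log r) (Set.Ici R) := by
    intro i
    have hd : ∀ r, 0 < r → HasDerivAt (fun r => U i r + (2 + δ) * Real.log r)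
        (U' i r + (2 + δ) * r⁻¹) r :=
      fun r hr => (h.hasDerivAt i r).add ((Real.hasDerivAt_log hr.ne').const_mul _)
    refine antitoneOn_of_hasDerivWithinAt_nonpos (convex_Ici R)
      (fun r hr => (hd r (hR0.trans_le hr)).continuousAt.continuousWithinAt)
      (fun r hr => (hd r (hR0.trans_le (interior_subset hr))).hasDerivWithinAt) fun r hr => ?_
    have hr' : R ≤ r := interior_subset hr
    have hr0 : 0 < r := hR0.trans_le hr'
    have h1 := (hR r hr').1 i
    have h2 : U' i r + (2 + δ) * r⁻¹ = (r * U' i r + (2 + δ)) / r := by field_simp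
    rw [h2]
    exact div_nonpos_of_nonpos_of_nonneg (by linarith) hr0.le
  refine ⟨δ, hδpos, R, hR0, ∑ i, Real.exp (U i R + (2 + δ) * Real.log R), by positivity,
    fun i r hr => ⟨(hR r hr).1 i, ?_⟩⟩
  have hr0 : 0 < r := hR0.trans_le hr
  have h1 := hanti i (Set.mem_Ici.2 le_rfl) (Set.mem_Ici.2 hr) hr
  simp only at h1
  calc Real.exp (U i r)
      ≤ Real.exp (U i R + (2 + δ) * Real.log R - (2 + δ) * Real.log r) :=
        Real.exp_le_exp.2 (by linarith)
    _ = Real.exp (U i R + (2 + δ) * Real.log R) * r ^ (-2 - δ) := by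
        rw [Real.rpow_def_of_pos hr0, ← Real.exp_add]; ring_nf
    _ ≤ _ := by
        gcongr
        exact Finset.single_le_sum (f := fun i => Real.exp (U i R + (2 + δ) * Real.log R))
          (fun _ _ => (Real.exp_pos _).le) (Finset.mem_univ i)

lemma tendsto_sq_mul_exp (h : IsLiouvilleProfile A U U') (hA : IsH1 A) (i : Fin n) :
    Filter.Tendsto (fun r => r ^ 2 * Real.exp (U i r)) Filter.atTop (𝓝 0) := by
  obtain ⟨δ, hδ, R, hR, C, -, hC⟩ := h.exists_decay hA
  have h1 : Filter.Tendsto (fun r : ℝ => C * r ^ (-δ)) Filter.atTop (𝓝 0) := by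
    simpa using (tendsto_rpow_neg_atTop hδ).const_mul C
  refine squeeze_zero' (Filter.Eventually.of_forall fun r => by positivity) ?_ h1
  filter_upwards [Filter.eventually_ge_atTop R] with r hr
  have hr0 : 0 < r := hR.trans_le hr
  calc r ^ 2 * Real.exp (U i r) ≤ r ^ 2 * (C * r ^ (-2 - δ)) := by
        gcongr; exact (hC i r hr).2
    _ = C * r ^ (-δ) := by
        rw [← Real.rpow_natCast, mul_left_comm, ← Real.rpow_add hr0]
        congr 2
        push_cast
        ring

/-- On a bounded interval the masses are comparable to `r²`. -/
lemma exists_radialMass_bounds (h : IsLiouvilleProfile A U U') (R : ℝ) :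
    ∃ c > 0, ∃ C > 0, ∀ i r, 0 ≤ r → r ≤ R → c * r ^ 2 ≤ radialMass U i r ∧
      radialMass U i r ≤ C * r ^ 2 ∧ c ≤ Real.exp (U i r) ∧ Real.exp (U i r) ≤ C := by
  choose K hK using fun i =>
    (isCompact_Icc (a := (0 : ℝ)) (b := R)).exists_bound_of_continuousOn
      (h.continuous i).continuousOn
  set B := ∑ i, |K i| with hB
  have hKB : ∀ i, K i ≤ B := fun i => (le_abs_self _).trans
    (Finset.single_le_sum (f := fun i => |K i|) (fun _ _ => abs_nonneg _) (Finset.mem_univ i))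
  have hlow : ∀ i s, 0 ≤ s → s ≤ R → Real.exp (-B) ≤ Real.exp (U i s) := fun i s h0 h1 =>
    Real.exp_le_exp.2 (by have := (abs_le.1 (hK i s ⟨h0, h1⟩)).1; linarith [hKB i])
  have hup : ∀ i s, 0 ≤ s → s ≤ R → Real.exp (U i s) ≤ Real.exp B := fun i s h0 h1 =>
    Real.exp_le_exp.2 (by have := (abs_le.1 (hK i s ⟨h0, h1⟩)).2; linarith [hKB i])
  have hint : ∀ c r : ℝ, ∫ s in (0 : ℝ)..r, s * c = c / 2 * r ^ 2 := by
    intro c r; rw [intervalIntegral.integral_mul_const, integral_id]; ring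
  have hc : ∀ i, Continuous fun s => s * Real.exp (U i s) := fun i =>
    continuous_id.mul (Real.continuous_exp.comp (h.continuous i))
  have hc' : ∀ c : ℝ, Continuous fun s : ℝ => s * c := fun c => continuous_id.mul continuous_const
  refine ⟨Real.exp (-B) / 2, by positivity, Real.exp B, by positivity,
    fun i r hr hrR => ⟨?_, ?_, ?_, hup i r hr hrR⟩⟩
  · rw [← hint]
    refine intervalIntegral.integral_mono_on hr ((hc' _).intervalIntegrable _ _)
      ((hc i).intervalIntegrable _ _) fun s hs => ?_
    exact mul_le_mul_of_nonneg_left (hlow i s hs.1 (hs.2.trans hrR)) hs.1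
  · have : radialMass U i r ≤ Real.exp B / 2 * r ^ 2 := by
      rw [← hint]
      refine intervalIntegral.integral_mono_on hr ((hc i).intervalIntegrable _ _)
        ((hc' _).intervalIntegrable _ _) fun s hs => ?_
      exact mul_le_mul_of_nonneg_left (hup i s hs.1 (hs.2.trans hrR)) hs.1
    have h2 : 0 ≤ Real.exp B * r ^ 2 := by positivity
    linarith
  · exact (half_le_self (Real.exp_pos _).le).trans (hlow i r hr hrR)

/-- On a bounded interval `-Uᵢ'` is comparable to `r`. -/
lemma exists_neg_deriv_bounds (h : IsLiouvilleProfile A U U') (hA : IsH1 A) (R : ℝ) :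
    ∃ c > 0, ∃ C > 0, ∀ i r, 0 ≤ r → r ≤ R → c * r ≤ -U' i r ∧ -U' i r ≤ C * r := by
  obtain ⟨c, hc, C, hC, hb⟩ := h.exists_radialMass_bounds R
  have hrow : ∀ᶠ d in 𝓝[>] (0 : ℝ), ∀ i, d ≤ ∑ j, A i j * c := by
    rw [Filter.eventually_all]
    intro i
    obtain ⟨j, hj⟩ := hA.exists_pos i
    have : 0 < ∑ j, A i j * c := Finset.sum_pos' (fun k _ => mul_nonneg (hA.nonneg i k) hc.le)
      ⟨j, Finset.mem_univ j, mul_pos hj hc⟩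
    filter_upwards [Ioo_mem_nhdsGT this] with d hd using hd.2.le
  obtain ⟨d, hd, hd0⟩ := (hrow.and self_mem_nhdsWithin).exists
  refine ⟨d, hd0, 1 + ∑ i, ∑ j, A i j * C, ?_, fun i r hr hrR => ?_⟩
  · have : 0 ≤ ∑ i, ∑ j, A i j * C := Finset.sum_nonneg fun i _ => Finset.sum_nonneg fun j _ =>
      mul_nonneg (hA.nonneg i j) hC.le
    linarith
  rcases hr.eq_or_lt with rfl | hr0
  · simp [h.deriv_zero]
  have h1 := h.mul_deriv_eq i hr
  have e1 : (∑ j, A i j * c) * r ^ 2 ≤ ∑ j, A i j * radialMass U j r := by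
    rw [Finset.sum_mul]
    refine Finset.sum_le_sum fun j _ => ?_
    rw [mul_assoc]
    exact mul_le_mul_of_nonneg_left (hb j r hr hrR).1 (hA.nonneg i j)
  have e2 : ∑ j, A i j * radialMass U j r ≤ (∑ j, A i j * C) * r ^ 2 := by
    rw [Finset.sum_mul]
    refine Finset.sum_le_sum fun j _ => ?_
    rw [mul_assoc]
    exact mul_le_mul_of_nonneg_left (hb j r hr hrR).2.1 (hA.nonneg i j)
  have e3 : ∑ j, A i j * C ≤ 1 + ∑ i, ∑ j, A i j * C := by
    have := Finset.single_le_sum (f := fun i => ∑ j, A i j * C)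
      (fun i _ => Finset.sum_nonneg fun j _ => mul_nonneg (hA.nonneg i j) hC.le)
      (Finset.mem_univ i)
    linarith
  constructor
  · refine le_of_mul_le_mul_left ?_ hr0
    nlinarith [mul_le_mul_of_nonneg_right (hd i) (sq_nonneg r)]
  · refine le_of_mul_le_mul_left ?_ hr0
    nlinarith [mul_le_mul_of_nonneg_right e3 (sq_nonneg r)]

/-- `-Uᵢ'` decays at least like `1 / r`. -/
lemma exists_neg_deriv_le (h : IsLiouvilleProfile A U U') (hA : IsH1 A) :
    ∃ C, ∀ i r, 0 < r → r * -U' i r ≤ C := by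
  refine ⟨∑ i, ∑ j, A i j * ∫ s in Set.Ioi (0 : ℝ), s * Real.exp (U j s), fun i r hr => ?_⟩
  have hnn : ∀ j, 0 ≤ ∫ s in Set.Ioi (0 : ℝ), s * Real.exp (U j s) := fun j =>
    setIntegral_nonneg measurableSet_Ioi fun s hs => mul_nonneg (le_of_lt hs) (Real.exp_pos _).le
  rw [mul_neg, h.mul_deriv_eq i hr.le, neg_neg]
  refine (Finset.sum_le_sum fun j _ => mul_le_mul_of_nonneg_left (h.radialMass_le j hr.le)
    (hA.nonneg i j)).trans ?_
  exact Finset.single_le_sum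
    (f := fun i => ∑ j, A i j * ∫ s in Set.Ioi (0 : ℝ), s * Real.exp (U j s))
    (fun i _ => Finset.sum_nonneg fun j _ => mul_nonneg (hA.nonneg i j) (hnn j))
    (Finset.mem_univ i)

end IsLiouvilleProfile

/-! ### Modes of positive frequency -/

/-- The operator `fᵢ'' + fᵢ' / r - k² fᵢ / r² + ∑ⱼ aᵢⱼ e^{Uⱼ} fⱼ` on the modes of frequency `k`. -/
noncomputable def modeOperator {n : ℕ} {A : Matrix (Fin n) (Fin n) ℝ} (hA : IsH1 A)
    (U : Fin n → ℝ → ℝ) (k : ℝ) : CooperativeOperator (Fin n) where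
  p _ r := r⁻¹
  c _ r := -(k ^ 2 / r ^ 2)
  b i j r := A i j * Real.exp (U j r)
  b_nonneg i j _ _ := mul_nonneg (hA.nonneg i j) (Real.exp_pos _).le

namespace IsModeSolution

variable {n : ℕ} {A : Matrix (Fin n) (Fin n) ℝ} {U U' : Fin n → ℝ → ℝ} {k : ℝ}
  {f f' f'' : Fin n → ℝ → ℝ}

lemma isSolution (hf : IsModeSolution A U k f f' f'') (hA : IsH1 A) :
    (modeOperator hA U k).IsSolution f f' where
  hasDerivAt i r _ := hf.hasDerivAt i r
  hasDerivAt' i r hr := by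
    refine (hf.hasDerivAt' i r).congr_deriv ?_
    have h := hf.equation i r
    have hr' := hr.ne'
    simp only [modeOperator]
    field_simp
    linear_combination h

lemma continuous (hf : IsModeSolution A U k f f' f'') (i : Fin n) : Continuous (f i) :=
  continuous_iff_continuousAt.2 fun r => (hf.hasDerivAt i r).continuousAt

lemma continuous' (hf : IsModeSolution A U k f f' f'') (i : Fin n) : Continuous (f' i) :=
  continuous_iff_continuousAt.2 fun r => (hf.hasDerivAt' i r).continuousAt

lemma apply_zero (hf : IsModeSolution A U k f f' f'') (hk : k ≠ 0) (i : Fin n) : f i 0 = 0 := by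
  have h := hf.equation i 0
  have : k ^ 2 * f i 0 = 0 := by linear_combination -h
  exact (mul_eq_zero.1 this).resolve_left (pow_ne_zero 2 hk)

lemma tendsto_div (hf : IsModeSolution A U k f f' f'') {i : Fin n} (h0 : f i 0 = 0) :
    Filter.Tendsto (fun r => f i r / r) (𝓝[>] 0) (𝓝 (f' i 0)) := by
  have h := (hf.hasDerivAt i 0).tendsto_slope_zero_right
  simp only [zero_add, h0, sub_zero, smul_eq_mul] at h
  exact h.congr fun r => by rw [div_eq_inv_mul]

/-- Regularity at the origin excludes a linear term in modes of frequency other than `1`. -/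
lemma deriv_zero (hf : IsModeSolution A U k f f' f'') (hU : ∀ i, Continuous (U i))
    (hk : k ≠ 0) (hk1 : k ^ 2 ≠ 1) (i : Fin n) : f' i 0 = 0 := by
  have hlim : Filter.Tendsto
      (fun r => r * f'' i r + f' i r - k ^ 2 * (f i r / r)
        + r * ∑ j, A i j * Real.exp (U j r) * f j r) (𝓝[>] 0)
      (𝓝 (0 * f'' i 0 + f' i 0 - k ^ 2 * f' i 0
        + 0 * ∑ j, A i j * Real.exp (U j 0) * f j 0)) := by
    have hid : Filter.Tendsto (fun r : ℝ => r) (𝓝[>] 0) (𝓝 0) := nhdsWithin_le_nhds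
    have e1 := (hf.continuous'' i).tendsto 0 |>.mono_left (nhdsWithin_le_nhds (s := Set.Ioi 0))
    have e2 := (hf.continuous' i).tendsto 0 |>.mono_left (nhdsWithin_le_nhds (s := Set.Ioi 0))
    have hc : Continuous fun r => ∑ j, A i j * Real.exp (U j r) * f j r := by
      have := hf.continuous
      fun_prop
    have e3 := hc.tendsto 0 |>.mono_left (nhdsWithin_le_nhds (s := Set.Ioi 0))
    exact (((hid.mul e1).add e2).sub ((hf.tendsto_div (hf.apply_zero hk i)).const_mul _)).add
      (hid.mul e3)
  have hz : (0 * f'' i 0 + f' i 0 - k ^ 2 * f' i 0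
      + 0 * ∑ j, A i j * Real.exp (U j 0) * f j 0) = 0 := by
    refine tendsto_nhds_unique hlim (tendsto_const_nhds.congr' ?_)
    filter_upwards [self_mem_nhdsWithin] with r hr
    have hr0 : r ≠ 0 := (Set.mem_Ioi.1 hr).ne'
    have h := hf.equation i r
    field_simp
    linear_combination -h
  have : (1 - k ^ 2) * f' i 0 = 0 := by linear_combination hz
  exact (mul_eq_zero.1 this).resolve_left (sub_ne_zero.2 hk1.symm)

end IsModeSolution

/-- A power `r ^ τ` with `0 < τ < k` is an exterior barrier for the modes of frequency `k`, since
`r² e^{Uⱼ} → 0`. -/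
lemma IsLiouvilleProfile.exists_isExteriorBarrier_rpow {n : ℕ} {A : Matrix (Fin n) (Fin n) ℝ}
    {U U' : Fin n → ℝ → ℝ} (h : IsLiouvilleProfile A U U') (hA : IsH1 A) {k τ : ℝ} (hτ : 0 < τ)
    (hτk : τ < k) :
    ∃ R > 0, (modeOperator hA U k).IsExteriorBarrier R (fun _ r => r ^ τ)
      (fun _ r => τ * r ^ (τ - 1)) (fun _ r => τ * ((τ - 1) * r ^ (τ - 1 - 1))) := by
  have hev : ∀ᶠ r in Filter.atTop, ∀ i,
      ∑ j, A i j * (r ^ 2 * Real.exp (U j r)) < k ^ 2 - τ ^ 2 := by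
    rw [Filter.eventually_all]
    intro i
    have hlim : Filter.Tendsto (fun r => ∑ j, A i j * (r ^ 2 * Real.exp (U j r))) Filter.atTop
        (𝓝 (∑ j, A i j * 0)) :=
      tendsto_finsetSum _ fun j _ => (h.tendsto_sq_mul_exp hA j).const_mul (A i j)
    simp only [mul_zero, Finset.sum_const_zero] at hlim
    exact hlim.eventually (gt_mem_nhds (by nlinarith))
  obtain ⟨R, hR⟩ := Filter.eventually_atTop.1 hev
  refine ⟨max R 1, lt_max_of_lt_right one_pos, ?_, ?_, ?_, ?_⟩
  · exact fun i r hr => Real.hasDerivAt_rpow_const (Or.inl hr.ne')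
  · exact fun i r hr => (Real.hasDerivAt_rpow_const (Or.inl hr.ne')).const_mul τ
  · intro i r hr
    have hr0 : 0 < r := one_pos.trans ((le_max_right R 1).trans_lt hr)
    have h1 := hR r ((le_max_left R 1).trans hr.le) i
    simp only [CooperativeOperator.eval, modeOperator]
    have e1 : r ^ (τ - 1) = r ^ τ / r := by rw [Real.rpow_sub_one hr0.ne']
    have e2 : r ^ (τ - 1 - 1) = r ^ τ / r / r := by
      rw [Real.rpow_sub_one hr0.ne', Real.rpow_sub_one hr0.ne']
    have e3 : ∑ j, A i j * (r ^ 2 * Real.exp (U j r))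
        = r ^ 2 * ∑ j, A i j * Real.exp (U j r) := by
      rw [Finset.mul_sum]; exact Finset.sum_congr rfl fun j _ => by ring
    rw [e3] at h1
    rw [e1, e2, ← Finset.sum_mul]
    have hpos : 0 < r ^ τ / r ^ 2 := by positivity
    have : τ * ((τ - 1) * (r ^ τ / r / r)) + r⁻¹ * (τ * (r ^ τ / r)) + -(k ^ 2 / r ^ 2) * r ^ τ
        + (∑ j, A i j * Real.exp (U j r)) * r ^ τ
        = (r ^ τ / r ^ 2) * (r ^ 2 * (∑ j, A i j * Real.exp (U j r)) - (k ^ 2 - τ ^ 2)) := by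
      have hr' := hr0.ne'
      field_simp
      ring
    rw [this]
    exact mul_neg_of_pos_of_neg hpos (by linarith)
  · exact fun i r hr => Real.rpow_pos_of_pos hr τ

/-- By translation invariance, `-U'` solves the equations of frequency `1`. Its derivative is
expressed through the Liouville system. -/
lemma IsLiouvilleProfile.isSolution_neg_deriv {n : ℕ} {A : Matrix (Fin n) (Fin n) ℝ}
    {U U' : Fin n → ℝ → ℝ} (h : IsLiouvilleProfile A U U') (hA : IsH1 A) :
    (modeOperator hA U 1).IsSolution (fun i r => -U' i r)
      (fun i r => U' i r / r + ∑ j, A i j * Real.exp (U j r)) where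
  hasDerivAt i r hr := (h.hasDerivAt' i r hr).neg.congr_deriv (by ring)
  hasDerivAt' i r hr := by
    refine (((h.hasDerivAt' i r hr).div (hasDerivAt_id r) hr.ne').add
      (HasDerivAt.fun_sum fun j _ => ((h.hasDerivAt j r).exp).const_mul (A i j))).congr_deriv ?_
    have e1 : ∑ j, A i j * Real.exp (U j r) * -U' j r
        = -∑ j, A i j * (Real.exp (U j r) * U' j r) := by
      rw [← Finset.sum_neg_distrib]; exact Finset.sum_congr rfl fun j _ => by ring
    simp only [modeOperator, id, e1]
    have hr' := hr.ne'
    field_simp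
    ring

lemma tendsto_div_rpow_of_growth {f : ℝ → ℝ} {C σ τ : ℝ} (hσ : 0 ≤ σ) (hστ : σ < τ)
    (hf : ∀ r, 0 ≤ r → |f r| ≤ C * (1 + r) ^ σ) :
    Filter.Tendsto (fun r => f r / r ^ τ) Filter.atTop (𝓝 0) := by
  have hC : 0 ≤ C := by
    have := (abs_nonneg _).trans (hf 0 le_rfl)
    simpa using this
  have hlim : Filter.Tendsto (fun r : ℝ => C * 2 ^ σ * r ^ (-(τ - σ))) Filter.atTop (𝓝 0) := by
    simpa using (tendsto_rpow_neg_atTop (sub_pos.2 hστ)).const_mul (C * 2 ^ σ)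
  refine squeeze_zero_norm' ?_ hlim
  filter_upwards [Filter.eventually_ge_atTop 1] with r hr
  have hr0 : 0 < r := one_pos.trans_le hr
  rw [norm_div, Real.norm_eq_abs, Real.norm_eq_abs, abs_of_pos (Real.rpow_pos_of_pos hr0 τ),
    div_le_iff₀ (Real.rpow_pos_of_pos hr0 τ)]
  calc |f r| ≤ C * (1 + r) ^ σ := hf r hr0.le
    _ ≤ C * (2 * r) ^ σ := by
        gcongr; linarith
    _ = C * 2 ^ σ * r ^ (-(τ - σ)) * r ^ τ := by
        rw [Real.mul_rpow two_pos.le hr0.le, mul_assoc (C * 2 ^ σ), ← Real.rpow_add hr0,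
          mul_assoc]
        congr 3
        ring

lemma IsLiouvilleProfile.tendsto_neg_deriv_div_rpow {n : ℕ} {A : Matrix (Fin n) (Fin n) ℝ}
    {U U' : Fin n → ℝ → ℝ} (h : IsLiouvilleProfile A U U') (hA : IsH1 A) {τ : ℝ} (hτ : 0 < τ)
    (i : Fin n) : Filter.Tendsto (fun r => -U' i r / r ^ τ) Filter.atTop (𝓝 0) := by
  obtain ⟨C, hC⟩ := h.exists_neg_deriv_le hA
  have hlim : Filter.Tendsto (fun r : ℝ => C * r ^ (-τ)) Filter.atTop (𝓝 0) := by
    simpa using (tendsto_rpow_neg_atTop hτ).const_mul C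
  refine squeeze_zero' ?_ ?_ hlim
  · filter_upwards [Filter.eventually_gt_atTop 0] with r hr
    exact div_nonneg (neg_nonneg.2 (h.deriv_neg hA i hr).le) (Real.rpow_nonneg hr.le _)
  · filter_upwards [Filter.eventually_ge_atTop 1] with r hr
    have hr0 : 0 < r := one_pos.trans_le hr
    rw [Real.rpow_neg hr0.le, div_eq_mul_inv]
    refine mul_le_mul_of_nonneg_right ?_ (inv_nonneg.2 (Real.rpow_nonneg hr0.le _))
    have h1 := hC i r hr0
    have h2 := (neg_pos.2 (h.deriv_neg hA i hr0))
    nlinarith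

/-- Modes of frequency `1` with growth of order less than `1` are multiples of `U'`. -/
theorem IsModeSolution.eq_const_mul_deriv {n : ℕ} [NeZero n] {A : Matrix (Fin n) (Fin n) ℝ}
    {U U' : Fin n → ℝ → ℝ} (hU : IsLiouvilleProfile A U U') (hA : IsH1 A)
    {f f' f'' : Fin n → ℝ → ℝ} (hf : IsModeSolution A U 1 f f' f'') {C σ : ℝ} (hσ : 0 ≤ σ)
    (hσ1 : σ < 1) (hgrowth : ∀ i r, 0 ≤ r → |f i r| ≤ C * (1 + r) ^ σ) :
    ∃ M, ∀ i r, 0 < r → f i r = M * U' i r := by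
  obtain ⟨τ, hστ, hτ1⟩ := exists_between hσ1
  have hτ : 0 < τ := hσ.trans_lt hστ
  obtain ⟨R, hR, hV⟩ := hU.exists_isExteriorBarrier_rpow hA hτ hτ1
  obtain ⟨c, hc, C', hC', hb⟩ := hU.exists_neg_deriv_bounds hA R
  have hf0 : ∀ i, f i 0 = 0 := hf.apply_zero one_ne_zero
  obtain ⟨K, hK⟩ : ∃ K, ∀ i r, 0 < r → r ≤ R → |f i r| ≤ K * r := by
    choose K hK using fun i =>
      (isCompact_Icc (a := (0 : ℝ)) (b := R)).exists_bound_of_continuousOn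
        (hf.continuous' i).continuousOn
    refine ⟨∑ i, |K i|, fun i r hr hrR => ?_⟩
    obtain ⟨s, hs, hs'⟩ := exists_hasDerivAt_eq_slope (f i) (f' i) hr
      (hf.continuous i).continuousOn fun s _ => hf.hasDerivAt i s
    rw [hf0, sub_zero, sub_zero, eq_div_iff hr.ne'] at hs'
    rw [← hs', abs_mul, abs_of_pos hr]
    refine mul_le_mul_of_nonneg_right ?_ hr.le
    exact (hK i s ⟨hs.1.le, hs.2.le.trans hrR⟩).trans ((le_abs_self _).trans
      (Finset.single_le_sum (f := fun i => |K i|) (fun _ _ => abs_nonneg _) (Finset.mem_univ i)))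
  have hid : Filter.Tendsto (fun r : ℝ => r) (𝓝[>] 0) (𝓝 0) := nhdsWithin_le_nhds
  have hS : (modeOperator hA U 1).IsDecoupledSolution (fun _ r => r) (fun _ _ => 1) (fun _ _ => 0)
      (fun _ r => r) := by
    refine ⟨fun i r _ => hasDerivAt_id r, fun i r _ => hasDerivAt_const r 1, fun i r hr => ?_,
      fun i r hr => hr, fun i r hr => ?_, fun i r hr => hr⟩
    · simp only [modeOperator]
      have := hr.ne'
      field_simp
      ring
    · refine (hasDerivAt_id r).congr_deriv ?_
      simp only [modeOperator]
      rw [inv_mul_cancel₀ hr.ne']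
  obtain ⟨M, hM⟩ := (hf.isSolution hA).eq_const_mul (hU.isSolution_neg_deriv hA)
    (fun i r hr => neg_pos.2 (hU.deriv_neg hA i hr)) hR hS (K := |K| / c) (K' := C')
    (fun i => by
      have h1 : Continuous fun r => r * (f' i r * r - f i r * 1) := by
        have := hf.continuous' i
        have := hf.continuous i
        fun_prop
      simpa using (h1.tendsto 0).mono_left (nhdsWithin_le_nhds (s := Set.Ioi 0)))
    (fun i => by
      have h1 : Continuous fun r => r * (2 * U' i r + r * ∑ j, A i j * Real.exp (U j r)) := by
        have := hU.continuous' i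
        have := hU.continuous
        fun_prop
      have h2 := (h1.tendsto 0).mono_left (nhdsWithin_le_nhds (s := Set.Ioi 0))
      rw [zero_mul] at h2
      refine h2.congr' ?_
      filter_upwards [self_mem_nhdsWithin] with r hr
      have : r ≠ 0 := (Set.mem_Ioi.1 hr).ne'
      field_simp
      ring)
    hV (fun i => tendsto_div_rpow_of_growth hσ hστ (hgrowth i))
    (fun i => hU.tendsto_neg_deriv_div_rpow hA hτ i)
    (fun i r hr hrR => by
      have h1 := (hb i r hr.le hrR).1
      calc |f i r| ≤ K * r := hK i r hr hrR
        _ ≤ |K| * r := mul_le_mul_of_nonneg_right (le_abs_self _) hr.le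
        _ = |K| / c * (c * r) := by field_simp
        _ ≤ |K| / c * -U' i r := mul_le_mul_of_nonneg_left h1 (by positivity))
    (fun i r hr hrR => (hb i r hr.le hrR).2)
    (fun Z hZ hcl => hA.eq_univ_of_closed hZ fun i hi j hij =>
      hcl i hi j fun r _ => mul_pos hij (Real.exp_pos _))
  exact ⟨-M, fun i r hr => by rw [hM i r hr]; ring⟩

/-- Modes of frequency `k > 1` with growth of order less than `k` vanish. -/
theorem IsModeSolution.eq_zero_of_one_lt {n : ℕ} {A : Matrix (Fin n) (Fin n) ℝ}
    {U U' : Fin n → ℝ → ℝ} (hU : IsLiouvilleProfile A U U') (hA : IsH1 A) {k : ℝ} (hk : 1 < k)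
    {f f' f'' : Fin n → ℝ → ℝ} (hf : IsModeSolution A U k f f' f'') {C σ : ℝ} (hσ : 0 ≤ σ)
    (hσk : σ < k) (hgrowth : ∀ i r, 0 ≤ r → |f i r| ≤ C * (1 + r) ^ σ) :
    ∀ i r, 0 < r → f i r = 0 := by
  obtain ⟨τ, hστ, hτk⟩ := exists_between hσk
  have hτ : 0 < τ := hσ.trans_lt hστ
  have hk0 : k ≠ 0 := by linarith
  obtain ⟨R, hR, hV⟩ := hU.exists_isExteriorBarrier_rpow hA hτ hτk
  obtain ⟨c, hc, _, _, hb⟩ := hU.exists_neg_deriv_bounds hA 1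
  have hg := hU.isSolution_neg_deriv hA
  obtain ⟨g'', hbar⟩ : ∃ g'', (modeOperator hA U k).IsExteriorBarrier 0 (fun i r => -U' i r)
      (fun i r => U' i r / r + ∑ j, A i j * Real.exp (U j r)) g'' := by
    refine ⟨_, hg.hasDerivAt, hg.hasDerivAt', fun i r hr => ?_,
      fun i r hr => neg_pos.2 (hU.deriv_neg hA i hr)⟩
    simp only [CooperativeOperator.eval, modeOperator]
    have h1 := neg_pos.2 (hU.deriv_neg hA i hr)
    have h2 : 0 < (k ^ 2 - 1) / r ^ 2 * -U' i r :=
      mul_pos (div_pos (by nlinarith) (pow_pos hr 2)) h1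
    rw [sub_div] at h2
    rw [one_pow]
    nlinarith
  refine (hf.isSolution hA).eq_zero_of_strict_supersolution hbar hR hV
    (fun i => tendsto_div_rpow_of_growth hσ hστ (hgrowth i))
    (fun i => hU.tendsto_neg_deriv_div_rpow hA hτ i) fun i => ?_
  -- `f = o(r)` at the origin, while `-U'` is bounded below by a multiple of `r`
  have h1 := (hf.tendsto_div (hf.apply_zero hk0 i)).norm
  rw [hf.deriv_zero hU.continuous hk0 (by nlinarith) i, norm_zero] at h1
  have h2 := h1.const_mul c⁻¹
  rw [mul_zero] at h2
  refine squeeze_zero_norm' ?_ h2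
  filter_upwards [Ioo_mem_nhdsGT one_pos] with r hr
  have h3 := (hb i r hr.1.le hr.2.le).1
  have h4 : 0 < -U' i r := neg_pos.2 (hU.deriv_neg hA i hr.1)
  have hr0 := hr.1
  rw [norm_div, norm_div, Real.norm_of_nonneg h4.le, Real.norm_of_nonneg hr.1.le,
    div_le_iff₀ h4]
  calc ‖f i r‖ = c⁻¹ * (‖f i r‖ / r) * (c * r) := by field_simp
    _ ≤ _ := by gcongr

/-! ### Modes of frequency zero -/

/-- The operator `wᵢ'' - (1 / r + Uᵢ') wᵢ' + ∑ⱼ aᵢⱼ e^{Uᵢ} wⱼ`, which annihilates the weighted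
integrals `wᵢ(r) = ∫₀ʳ s e^{Uᵢ} fᵢ` of the modes `f` of frequency `0`. -/
noncomputable def massOperator {n : ℕ} {A : Matrix (Fin n) (Fin n) ℝ} (hA : IsH1 A)
    (U U' : Fin n → ℝ → ℝ) : CooperativeOperator (Fin n) where
  p i r := -(r⁻¹ + U' i r)
  c _ _ := 0
  b i j r := A i j * Real.exp (U i r)
  b_nonneg i j _ _ := mul_nonneg (hA.nonneg i j) (Real.exp_pos _).le

/-- The weighted integral `∫₀ʳ s e^{Uᵢ(s)} fᵢ(s) ds`. -/
noncomputable def linearizedMass {n : ℕ} (U f : Fin n → ℝ → ℝ) (i : Fin n) (r : ℝ) : ℝ :=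
  ∫ s in (0 : ℝ)..r, s * Real.exp (U i s) * f i s

lemma linearizedMass_zero {n : ℕ} (U f : Fin n → ℝ → ℝ) (i : Fin n) : linearizedMass U f i 0 = 0 :=
  intervalIntegral.integral_same

/-- A pair `(w, f)` with `wᵢ' = r e^{Uᵢ} fᵢ` and `r fᵢ' = - ∑ⱼ aᵢⱼ wⱼ` gives a solution `w`. -/
lemma massOperator_isSolution {n : ℕ} {A : Matrix (Fin n) (Fin n) ℝ} (hA : IsH1 A)
    {U U' w f : Fin n → ℝ → ℝ} (hU : ∀ i r, HasDerivAt (U i) (U' i r) r)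
    (hw : ∀ i r, 0 < r → HasDerivAt (w i) (r * Real.exp (U i r) * f i r) r)
    (hf : ∀ i r, 0 < r → HasDerivAt (f i) (-(∑ j, A i j * w j r) / r) r) :
    (massOperator hA U U').IsSolution w (fun i r => r * Real.exp (U i r) * f i r) where
  hasDerivAt := hw
  hasDerivAt' i r hr := by
    refine (((hasDerivAt_id r).mul (hU i r).exp).mul (hf i r hr)).congr_deriv ?_
    have e1 : ∑ j, A i j * Real.exp (U i r) * w j r = Real.exp (U i r) * ∑ j, A i j * w j r := by
      rw [Finset.mul_sum]; exact Finset.sum_congr rfl fun j _ => by ring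
    simp only [massOperator, e1, id, Pi.mul_apply]
    have hr' := hr.ne'
    field_simp
    ring

namespace IsModeSolution

variable {n : ℕ} {A : Matrix (Fin n) (Fin n) ℝ} {U U' : Fin n → ℝ → ℝ}
  {f f' f'' : Fin n → ℝ → ℝ}

lemma hasDerivAt_linearizedMass (hU : IsLiouvilleProfile A U U')
    (hf : ∀ i, Continuous (f i)) (i : Fin n) (r : ℝ) :
    HasDerivAt (linearizedMass U f i) (r * Real.exp (U i r) * f i r) r := by
  have hc : Continuous fun s => s * Real.exp (U i s) * f i s := by
    have := hU.continuous i
    have := hf i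
    fun_prop
  exact intervalIntegral.integral_hasDerivAt_right (hc.intervalIntegrable _ _)
    hc.stronglyMeasurable.stronglyMeasurableAtFilter hc.continuousAt

lemma mul_deriv_eq (hf : IsModeSolution A U 0 f f' f'') (hU : IsLiouvilleProfile A U U')
    (i : Fin n) {r : ℝ} (hr : 0 ≤ r) :
    r * f' i r = -∑ j, A i j * linearizedMass U f j r := by
  set F : ℝ → ℝ := fun r => r * f' i r + ∑ j, A i j * linearizedMass U f j r with hF
  have hFd : ∀ r, 0 < r → HasDerivAt F 0 r := by
    intro r hr
    refine (((hasDerivAt_id r).mul (hf.hasDerivAt' i r)).add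
      (HasDerivAt.fun_sum fun j _ =>
        (hasDerivAt_linearizedMass hU hf.continuous j r).const_mul (A i j))).congr_deriv ?_
    have e1 : ∑ j, A i j * (r * Real.exp (U j r) * f j r)
        = r * ∑ j, A i j * Real.exp (U j r) * f j r := by
      rw [Finset.mul_sum]; exact Finset.sum_congr rfl fun j _ => by ring
    have h := hf.equation i r
    rw [e1]
    simp only [id]
    refine mul_left_cancel₀ hr.ne' ?_
    linear_combination h
  have hFc : Continuous F := (continuous_id.mul (hf.continuous' i)).add
    (continuous_finsetSum _ fun j _ => continuous_const.mul
      (continuous_iff_continuousAt.2 fun r =>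
        (hasDerivAt_linearizedMass hU hf.continuous j r).continuousAt))
  have h0 : F 0 = 0 := by simp [hF, linearizedMass_zero]
  rcases hr.eq_or_lt with rfl | hr'
  · simp [linearizedMass_zero]
  obtain ⟨c, hc, hc'⟩ := exists_hasDerivAt_eq_slope F (fun _ => 0) hr' hFc.continuousOn
    fun s hs => hFd s hs.1
  rw [h0, sub_zero, sub_zero, eq_div_iff hr'.ne', zero_mul] at hc'
  have : F r = 0 := hc'.symm
  simp only [hF] at this
  linarith

end IsModeSolution

/-- A function for which `r f'(r)` has a nonzero limit at infinity grows logarithmically, so it is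
unbounded. -/
lemma eq_zero_of_tendsto_mul_deriv_of_bounded {f f' : ℝ → ℝ} {L C : ℝ}
    (hf : ∀ r, HasDerivAt f (f' r) r)
    (hL : Filter.Tendsto (fun r => r * f' r) Filter.atTop (𝓝 L))
    (hC : ∀ r, 0 ≤ r → |f r| ≤ C) : L = 0 := by
  -- it suffices to exclude positive limits
  have key : ∀ {f f' : ℝ → ℝ} {L : ℝ}, (∀ r, HasDerivAt f (f' r) r) →
      Filter.Tendsto (fun r => r * f' r) Filter.atTop (𝓝 L) → (∀ r, 0 ≤ r → |f r| ≤ C) → L ≤ 0 := by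
    intro f f' L hf hL hC
    by_contra! hpos
    obtain ⟨R, hR⟩ := Filter.eventually_atTop.1
      ((hL.eventually (lt_mem_nhds (half_lt_self hpos))).and (Filter.eventually_gt_atTop 0))
    have hR0 : 0 < R := (hR R le_rfl).2
    have hmono : MonotoneOn (fun r => f r - L / 2 * Real.log r) (Set.Ici R) := by
      have hd : ∀ r, 0 < r → HasDerivAt (fun r => f r - L / 2 * Real.log r)
          (f' r - L / 2 * r⁻¹) r :=
        fun r hr => (hf r).sub ((Real.hasDerivAt_log hr.ne').const_mul _)
      refine monotoneOn_of_hasDerivWithinAt_nonneg (convex_Ici R)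
        (fun r hr => (hd r (hR0.trans_le hr)).continuousAt.continuousWithinAt)
        (fun r hr => (hd r (hR0.trans_le (interior_subset hr))).hasDerivWithinAt) fun r hr => ?_
      have hr' : R ≤ r := interior_subset hr
      have hr0 : 0 < r := hR0.trans_le hr'
      have h2 : f' r - L / 2 * r⁻¹ = (r * f' r - L / 2) / r := by field_simp
      rw [h2]
      exact div_nonneg (by linarith [(hR r hr').1]) hr0.le
    have hlog : Filter.Tendsto (fun r => L / 2 * Real.log r) Filter.atTop Filter.atTop :=
      Real.tendsto_log_atTop.const_mul_atTop (half_pos hpos)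
    obtain ⟨r, hr, hrR⟩ := ((hlog.eventually_gt_atTop
      (2 * C + L / 2 * Real.log R)).and (Filter.eventually_ge_atTop R)).exists
    have h1 := hmono (Set.mem_Ici.2 le_rfl) (Set.mem_Ici.2 hrR) hrR
    simp only at h1
    have h2 := (abs_le.1 (hC r (hR0.le.trans hrR))).2
    have h3 := (abs_le.1 (hC R hR0.le)).1
    linarith
  refine le_antisymm (key hf hL hC) ?_
  have := key (f := fun r => -f r) (f' := fun r => -f' r) (L := -L) (fun r => (hf r).neg)
    (hL.neg.congr fun r => by ring) (fun r hr => by rw [abs_neg]; exact hC r hr)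
  linarith

/-- Bounded modes of frequency `0` have total mass zero: `r fᵢ'` tends to `-∑ⱼ aᵢⱼ wⱼ(∞)`, and a
nonzero limit would make `fᵢ` grow logarithmically. -/
lemma IsModeSolution.tendsto_linearizedMass {n : ℕ} {A : Matrix (Fin n) (Fin n) ℝ}
    {U U' : Fin n → ℝ → ℝ} (hU : IsLiouvilleProfile A U U') (hA : IsH1 A)
    {f f' f'' : Fin n → ℝ → ℝ} (hf : IsModeSolution A U 0 f f' f'') {C : ℝ}
    (hC : ∀ i r, 0 ≤ r → |f i r| ≤ C) (i : Fin n) :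
    Filter.Tendsto (linearizedMass U f i) Filter.atTop (𝓝 0) := by
  -- the limits `W` of the weighted integrals satisfy `A W = 0`
  set W : Fin n → ℝ := fun i => ∫ s in Set.Ioi (0 : ℝ), s * Real.exp (U i s) * f i s with hW
  have hlim : ∀ i, Filter.Tendsto (linearizedMass U f i) Filter.atTop (𝓝 (W i)) := by
    intro i
    refine intervalIntegral_tendsto_integral_Ioi 0 ?_ Filter.tendsto_id
    refine (hU.energy i).mul_bdd (c := C) (hf.continuous i).aestronglyMeasurable ?_
    exact (ae_restrict_mem measurableSet_Ioi).mono fun s hs => hC i s (le_of_lt hs)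
  have hAW : A.mulVec W = 0 := by
    funext i
    have h1 : Filter.Tendsto (fun r => r * f' i r) Filter.atTop (𝓝 (-∑ j, A i j * W j)) := by
      refine (tendsto_finsetSum Finset.univ fun j _ => (hlim j).const_mul (A i j)).neg.congr' ?_
      filter_upwards [Filter.eventually_ge_atTop 0] with r hr
      exact (hf.mul_deriv_eq hU i hr).symm
    have h2 := eq_zero_of_tendsto_mul_deriv_of_bounded (hf.hasDerivAt i) h1 (hC i)
    rw [Pi.zero_apply]
    exact neg_eq_zero.1 h2
  have hW0 : W = 0 := Matrix.eq_zero_of_mulVec_eq_zero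
    ((Matrix.isUnit_iff_isUnit_det A).1 hA.invertible).ne_zero hAW
  have := hlim i
  rwa [hW0] at this

/-- A function which tends to `0` at infinity and whose derivative is bounded by a power is bounded
by the integral of this power. -/
lemma abs_le_of_tendsto_zero_of_abs_deriv_le {w w' : ℝ → ℝ} {R C δ : ℝ} (hR : 0 < R) (hδ : 0 < δ)
    (hw : ∀ r, HasDerivAt w (w' r) r) (hlim : Filter.Tendsto w Filter.atTop (𝓝 0))
    (hb : ∀ r, R ≤ r → |w' r| ≤ C * r ^ (-1 - δ)) {r : ℝ} (hr : R ≤ r) :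
    |w r| ≤ C / δ * r ^ (-δ) := by
  have key : ∀ {w w' : ℝ → ℝ}, (∀ r, HasDerivAt w (w' r) r) →
      Filter.Tendsto w Filter.atTop (𝓝 0) → (∀ r, R ≤ r → w' r ≤ C * r ^ (-1 - δ)) →
      -w r ≤ C / δ * r ^ (-δ) := by
    intro w w' hw hlim hb
    have hd : ∀ s, 0 < s → HasDerivAt (fun r => w r + C / δ * r ^ (-δ))
        (w' s + C / δ * (-δ * s ^ (-δ - 1))) s :=
      fun s hs => (hw s).add ((Real.hasDerivAt_rpow_const (Or.inl hs.ne')).const_mul _)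
    have hanti : AntitoneOn (fun r => w r + C / δ * r ^ (-δ)) (Set.Ici R) := by
      refine antitoneOn_of_hasDerivWithinAt_nonpos (convex_Ici R)
        (fun r hr => (hd r (hR.trans_le hr)).continuousAt.continuousWithinAt)
        (fun r hr => (hd r (hR.trans_le (interior_subset hr))).hasDerivWithinAt) fun s hs => ?_
      have h1 := hb s (interior_subset hs)
      have h2 : C / δ * (-δ * s ^ (-δ - 1)) = -(C * s ^ (-1 - δ)) := by
        rw [show -δ - 1 = -1 - δ by ring]
        field_simp
      rw [h2]
      linarith
    have hlim' : Filter.Tendsto (fun r => w r + C / δ * r ^ (-δ)) Filter.atTop (𝓝 0) := by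
      simpa using hlim.add ((tendsto_rpow_neg_atTop hδ).const_mul (C / δ))
    have : 0 ≤ w r + C / δ * r ^ (-δ) := by
      refine le_of_tendsto hlim' ?_
      filter_upwards [Filter.eventually_ge_atTop r] with s hs
      exact hanti (Set.mem_Ici.2 hr) (Set.mem_Ici.2 (hr.trans hs)) hs
    linarith
  refine abs_le'.2 ⟨?_, key hw hlim fun s hs => (le_abs_self _).trans (hb s hs)⟩
  have := key (w := fun r => -w r) (w' := fun r => -w' r) (fun r => (hw r).neg)
    (by simpa using hlim.neg) fun s hs => (neg_le_abs _).trans (hb s hs)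
  simpa using this

/-- A power `r ^ (-β)` with small `β > 0` is an exterior barrier for the weighted integrals. -/
lemma IsLiouvilleProfile.exists_isExteriorBarrier_mass {n : ℕ} {A : Matrix (Fin n) (Fin n) ℝ}
    {U U' : Fin n → ℝ → ℝ} (h : IsLiouvilleProfile A U U') (hA : IsH1 A) {β δ R₀ : ℝ} (hβ : 0 < β)
    (hβδ : β < δ) (hδ : ∀ i r, R₀ ≤ r → r * U' i r ≤ -2 - δ) :
    ∃ R > 0, (massOperator hA U U').IsExteriorBarrier R (fun _ r => r ^ (-β))
      (fun _ r => -β * r ^ (-β - 1)) (fun _ r => -β * ((-β - 1) * r ^ (-β - 1 - 1))) := by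
  have hev : ∀ᶠ r in Filter.atTop, ∀ i,
      (∑ j, A i j) * (r ^ 2 * Real.exp (U i r)) < β * (δ - β) := by
    rw [Filter.eventually_all]
    intro i
    have hlim := (h.tendsto_sq_mul_exp hA i).const_mul (∑ j, A i j)
    rw [mul_zero] at hlim
    exact hlim.eventually (gt_mem_nhds (mul_pos hβ (by linarith)))
  obtain ⟨R, hR⟩ := Filter.eventually_atTop.1 hev
  refine ⟨max (max R R₀) 1, lt_max_of_lt_right one_pos, ?_, ?_, ?_, ?_⟩
  · exact fun i r hr => Real.hasDerivAt_rpow_const (Or.inl hr.ne')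
  · exact fun i r hr => (Real.hasDerivAt_rpow_const (Or.inl hr.ne')).const_mul (-β)
  · intro i r hr
    have hr0 : 0 < r := one_pos.trans ((le_max_right _ 1).trans_lt hr)
    have hr1 := (le_max_left _ (1 : ℝ)).trans hr.le
    have h1 := hR r ((le_max_left R R₀).trans hr1) i
    have h2 := hδ i r ((le_max_right R R₀).trans hr1)
    simp only [CooperativeOperator.eval, massOperator]
    have e1 : r ^ (-β - 1) = r ^ (-β) / r := by rw [Real.rpow_sub_one hr0.ne']
    have e2 : r ^ (-β - 1 - 1) = r ^ (-β) / r / r := by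
      rw [Real.rpow_sub_one hr0.ne', Real.rpow_sub_one hr0.ne']
    rw [e1, e2, ← Finset.sum_mul, ← Finset.sum_mul]
    have hpos : 0 < r ^ (-β) / r ^ 2 := by positivity
    have : -β * ((-β - 1) * (r ^ (-β) / r / r)) + -(r⁻¹ + U' i r) * (-β * (r ^ (-β) / r))
        + 0 * r ^ (-β) + (∑ j, A i j) * Real.exp (U i r) * r ^ (-β)
        = (r ^ (-β) / r ^ 2) * (β * (β + 2 + r * U' i r)
          + (∑ j, A i j) * (r ^ 2 * Real.exp (U i r))) := by
      have hr' := hr0.ne'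
      field_simp
      ring
    rw [this]
    refine mul_neg_of_pos_of_neg hpos ?_
    have h3 : β * (β + 2 + r * U' i r) ≤ β * (β - δ) :=
      mul_le_mul_of_nonneg_left (by linarith) hβ.le
    linarith
  · exact fun i r hr => Real.rpow_pos_of_pos hr _

/-- Bounded modes of frequency `0` are multiples of `r U' + 2`. The corresponding weighted integral
is the positive function `r² e^U`. -/
theorem IsModeSolution.eq_const_mul_of_bounded {n : ℕ} [NeZero n] {A : Matrix (Fin n) (Fin n) ℝ}
    {U U' : Fin n → ℝ → ℝ} (hU : IsLiouvilleProfile A U U') (hA : IsH1 A)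
    {f f' f'' : Fin n → ℝ → ℝ} (hf : IsModeSolution A U 0 f f' f'') {C : ℝ}
    (hC : ∀ i r, 0 ≤ r → |f i r| ≤ C) :
    ∃ M, ∀ i r, 0 < r → f i r = M * (r * U' i r + 2) := by
  obtain ⟨δ, hδ, R₀, hR₀, D, hD, hdec⟩ := hU.exists_decay hA
  have hC0 : 0 ≤ C := (abs_nonneg _).trans (hC 0 0 le_rfl)
  obtain ⟨R, hR, hV⟩ := hU.exists_isExteriorBarrier_mass hA (half_pos hδ) (half_lt_self hδ)
    fun i r hr => (hdec i r hr).1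
  obtain ⟨c, hc, B, hB, hb⟩ := hU.exists_radialMass_bounds R
  have hsol := massOperator_isSolution hA hU.hasDerivAt
    (fun i r _ => IsModeSolution.hasDerivAt_linearizedMass hU hf.continuous i r) fun i r hr => by
      refine (hf.hasDerivAt i r).congr_deriv ?_
      rw [eq_div_iff hr.ne', ← hf.mul_deriv_eq hU i hr.le, mul_comm]
  have hg : (massOperator hA U U').IsSolution (fun i r => r ^ 2 * Real.exp (U i r))
      (fun i r => r * Real.exp (U i r) * (r * U' i r + 2)) := by
    refine massOperator_isSolution hA hU.hasDerivAt (fun i r _ => ?_) fun i r hr => ?_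
    · refine ((hasDerivAt_pow 2 r).mul (hU.hasDerivAt i r).exp).congr_deriv ?_
      push_cast
      ring
    · refine (((hasDerivAt_id r).mul (hU.hasDerivAt' i r hr)).add_const 2).congr_deriv ?_
      have e1 : ∑ j, A i j * (r ^ 2 * Real.exp (U j r))
          = r ^ 2 * ∑ j, A i j * Real.exp (U j r) := by
        rw [Finset.mul_sum]; exact Finset.sum_congr rfl fun j _ => by ring
      rw [e1]
      simp only [id]
      have := hr.ne'
      field_simp
      ring
  have hS : (massOperator hA U U').IsDecoupledSolution (radialMass U)
      (fun i r => r * Real.exp (U i r)) (fun i r => (1 + r * U' i r) * Real.exp (U i r))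
      (fun i r => Real.exp (-U i r) / r) := by
    refine ⟨fun i r _ => hU.hasDerivAt_radialMass i r, fun i r _ => ?_, fun i r hr => ?_,
      fun i r hr => hU.radialMass_pos i hr, fun i r hr => ?_, fun i r hr => by positivity⟩
    · refine ((hasDerivAt_id r).mul (hU.hasDerivAt i r).exp).congr_deriv ?_
      simp only [id]
      ring
    · simp only [massOperator]
      have := hr.ne'
      field_simp
      ring
    · refine ((hU.hasDerivAt i r).neg.exp.div (hasDerivAt_id r) hr.ne').congr_deriv ?_
      simp only [massOperator, id, Pi.neg_apply]
      have := hr.ne'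
      field_simp
      ring
  -- the weighted Wronskian of `w` and the mass is `f S - w`, which vanishes at the origin
  have hwr : ∀ {w f : ℝ → ℝ} (i : Fin n), Continuous w → Continuous f → w 0 = 0 →
      Filter.Tendsto (fun r => Real.exp (-U i r) / r *
        (r * Real.exp (U i r) * f r * radialMass U i r - w r * (r * Real.exp (U i r))))
        (𝓝[>] 0) (𝓝 0) := by
    intro w f i hw hf hw0
    have h1 : Continuous fun r => f r * radialMass U i r - w r := by
      have : Continuous (radialMass U i) := continuous_iff_continuousAt.2 fun r =>
        (hU.hasDerivAt_radialMass i r).continuousAt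
      fun_prop
    have h2 := (h1.tendsto 0).mono_left (nhdsWithin_le_nhds (s := Set.Ioi 0))
    rw [IsLiouvilleProfile.radialMass_zero, hw0, mul_zero, sub_zero] at h2
    refine h2.congr' ?_
    filter_upwards [self_mem_nhdsWithin] with r hr
    have hr0 : r ≠ 0 := (Set.mem_Ioi.1 hr).ne'
    rw [Real.exp_neg]
    field_simp
  have hdecay : ∀ K : ℝ, Filter.Tendsto (fun r : ℝ => K * r ^ (-(δ / 2))) Filter.atTop (𝓝 0) :=
    fun K => by simpa using (tendsto_rpow_neg_atTop (half_pos hδ)).const_mul K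
  have hquot : ∀ {r : ℝ} (K : ℝ), 0 < r → K * r ^ (-δ) / r ^ (-(δ / 2)) = K * r ^ (-(δ / 2)) := by
    intro r K hr
    rw [mul_div_assoc, ← Real.rpow_sub hr]
    congr 2
    ring
  obtain ⟨M, hM⟩ := hsol.eq_const_mul hg (fun i r hr => by positivity) hR hS
    (K := C * B / c) (K' := B / c)
    (fun i => hwr i (continuous_iff_continuousAt.2 fun r =>
      (IsModeSolution.hasDerivAt_linearizedMass hU hf.continuous i r).continuousAt)
      (hf.continuous i) (linearizedMass_zero U f i))
    (fun i => by
      have := hU.continuous i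
      have := hU.continuous' i
      exact hwr i (w := fun r => r ^ 2 * Real.exp (U i r)) (f := fun r => r * U' i r + 2)
        (by fun_prop) (by fun_prop) (by simp))
    hV
    (fun i => by
      refine squeeze_zero_norm' ?_ (hdecay (D * C / δ))
      filter_upwards [Filter.eventually_ge_atTop R₀] with r hr
      have hr0 := hR₀.trans_le hr
      rw [norm_div, Real.norm_of_nonneg (Real.rpow_nonneg hr0.le _), ← hquot _ hr0]
      refine div_le_div_of_nonneg_right ?_ (Real.rpow_nonneg hr0.le _)
      refine abs_le_of_tendsto_zero_of_abs_deriv_le hR₀ hδ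
        (fun r => IsModeSolution.hasDerivAt_linearizedMass hU hf.continuous i r)
        (hf.tendsto_linearizedMass hU hA hC i) (fun s hs => ?_) hr
      have hs0 := hR₀.trans_le hs
      rw [abs_mul, abs_of_pos (mul_pos hs0 (Real.exp_pos _))]
      calc s * Real.exp (U i s) * |f i s| ≤ s * (D * s ^ (-2 - δ)) * C := by
            gcongr
            · exact (hdec i s hs).2
            · exact hC i s hs0.le
        _ = D * C * s ^ (-1 - δ) := by
            rw [show -1 - δ = 1 + (-2 - δ) by ring, Real.rpow_add hs0, Real.rpow_one]
            ring)
    (fun i => by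
      refine squeeze_zero_norm' ?_ (hdecay D)
      filter_upwards [Filter.eventually_ge_atTop R₀] with r hr
      have hr0 := hR₀.trans_le hr
      rw [norm_div, Real.norm_of_nonneg (Real.rpow_nonneg hr0.le _), ← hquot _ hr0]
      refine div_le_div_of_nonneg_right ?_ (Real.rpow_nonneg hr0.le _)
      rw [Real.norm_of_nonneg (by positivity)]
      calc r ^ 2 * Real.exp (U i r) ≤ r ^ 2 * (D * r ^ (-2 - δ)) := by
            gcongr; exact (hdec i r hr).2
        _ = D * r ^ (-δ) := by
            rw [show -δ = 2 + (-2 - δ) by ring, Real.rpow_add hr0, Real.rpow_two]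
            ring)
    (fun i r hr hrR => by
      obtain ⟨-, h2, h3, -⟩ := hb i r hr.le hrR
      have h1 : |linearizedMass U f i r| ≤ C * radialMass U i r := by
        have hc' : Continuous fun s => C * (s * Real.exp (U i s)) := by
          have := hU.continuous i
          fun_prop
        have := intervalIntegral.norm_integral_le_of_norm_le hr.le
          (f := fun s => s * Real.exp (U i s) * f i s)
          (Filter.Eventually.of_forall fun s hs => by
            rw [norm_mul, Real.norm_of_nonneg (mul_nonneg hs.1.le (Real.exp_pos _).le), mul_comm]
            exact mul_le_mul_of_nonneg_right (hC i s hs.1.le)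
              (mul_nonneg hs.1.le (Real.exp_pos _).le))
          (hc'.intervalIntegrable (μ := volume) 0 r)
        rwa [intervalIntegral.integral_const_mul] at this
      calc |linearizedMass U f i r| ≤ C * radialMass U i r := h1
        _ ≤ C * (B * r ^ 2) := by gcongr
        _ = C * B / c * (r ^ 2 * c) := by field_simp
        _ ≤ _ := by gcongr)
    (fun i r hr hrR => by
      obtain ⟨h1, -, -, h3⟩ := hb i r hr.le hrR
      calc r ^ 2 * Real.exp (U i r) ≤ r ^ 2 * B := by gcongr
        _ = B / c * (c * r ^ 2) := by field_simp
        _ ≤ _ := by gcongr)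
    (fun Z hZ hcl => hA.eq_univ_of_closed hZ fun i hi j hij =>
      hcl i hi j fun r _ => mul_pos hij (Real.exp_pos _))
  refine ⟨M, fun i r hr => ?_⟩
  have h1 := (hsol.hasDerivAt i r hr).unique
    (((hg.hasDerivAt i r hr).const_mul M).congr_of_eventuallyEq
    (by filter_upwards [lt_mem_nhds hr] with s hs using hM i s hs))
  have h2 : r * Real.exp (U i r) ≠ 0 := (mul_pos hr (Real.exp_pos _)).ne'
  refine mul_left_cancel₀ h2 ?_
  linear_combination h1

/-! ### Modes of frequency zero and one with vanishing initial data -/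

namespace IsModeSolution

variable {n : ℕ} {A : Matrix (Fin n) (Fin n) ℝ} {U : Fin n → ℝ → ℝ} {f f' f'' : Fin n → ℝ → ℝ}

lemma eq_zero_of_apply_zero (hf : IsModeSolution A U 0 f f' f'') (hU : ∀ i, Continuous (U i))
    (h0 : ∀ i, f i 0 = 0) : ∀ i r, 0 ≤ r → f i r = 0 := by
  refine eq_zero_of_singular_initial_value (m := 1) (q := fun i r => r * f' i r)
    (B := fun i j r => A i j * Real.exp (U j r)) (fun i j => ?_)
    (fun i => (hf.continuous i).continuousOn)
    (fun i => (continuous_id.mul (hf.continuous' i)).continuousOn) h0 (fun i => zero_mul _)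
    (fun i r hr => ?_) (fun i r hr => ?_)
  · have := hU j
    fun_prop
  · refine (hf.hasDerivAt i r).congr_deriv ?_
    rw [pow_one, mul_div_cancel_left₀ _ hr.ne']
  · refine ((hasDerivAt_id r).mul (hf.hasDerivAt' i r)).congr_deriv ?_
    have h := hf.equation i r
    simp only [id]
    refine mul_left_cancel₀ hr.ne' ?_
    linear_combination h

lemma eq_zero_of_deriv_zero (hf : IsModeSolution A U 1 f f' f'') (hU : ∀ i, Continuous (U i))
    (h0 : ∀ i, f' i 0 = 0) : ∀ i r, 0 ≤ r → f i r = 0 := by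
  have key := eq_zero_of_singular_initial_value (m := 3) (y := fun i r => f i r / r)
    (q := fun i r => r ^ 2 * f' i r - r * f i r)
    (B := fun i j r => A i j * Real.exp (U j r)) (fun i j => ?_)
    (fun i => ?_) (fun i => ?_) (fun i => div_zero _) (fun i => by simp)
    (fun i r hr => ?_) (fun i r hr => ?_)
  · intro i r hr
    rcases hr.eq_or_lt with rfl | hr'
    · exact hf.apply_zero one_ne_zero i
    · exact (div_eq_zero_iff.1 (key i r hr)).resolve_right hr'.ne'
  · have := hU j
    fun_prop
  · intro r hr
    rcases (Set.mem_Ici.1 hr).eq_or_lt with rfl | hr'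
    · rw [← continuousWithinAt_Ioi_iff_Ici, ContinuousWithinAt, div_zero]
      have := hf.tendsto_div (hf.apply_zero one_ne_zero i)
      rwa [h0 i] at this
    · exact ((hf.continuous i).continuousAt.div continuousAt_id hr'.ne').continuousWithinAt
  · have := hf.continuous i
    have := hf.continuous' i
    exact Continuous.continuousOn (by fun_prop)
  · refine ((hf.hasDerivAt i r).div (hasDerivAt_id r) hr.ne').congr_deriv ?_
    have := hr.ne'
    simp only [id]
    field_simp
  · refine (((hasDerivAt_pow 2 r).mul (hf.hasDerivAt' i r)).sub
      ((hasDerivAt_id r).mul (hf.hasDerivAt i r))).congr_deriv ?_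
    have h := hf.equation i r
    have e1 : ∑ j, A i j * Real.exp (U j r) * (f j r / r)
        = (∑ j, A i j * Real.exp (U j r) * f j r) / r := by
      rw [Finset.sum_div]; exact Finset.sum_congr rfl fun j _ => by ring
    have hr' := hr.ne'
    rw [e1]
    simp only [id]
    push_cast
    field_simp
    linear_combination h

end IsModeSolution

/-! ### Classification of the solutions of the linearized system -/

lemma radialPartial_zero (f : Plane → ℝ) (k : Fin 2) : radialPartial f k 0 = 0 := by
  simp [radialPartial]

lemma radialPartial_smul_polarDir (f : Plane → ℝ) {r : ℝ} (hr : 0 < r) (θ : ℝ) :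
    radialPartial f 0 (r • polarDir θ) = radialDeriv f r * Real.cos θ ∧
      radialPartial f 1 (r • polarDir θ) = radialDeriv f r * Real.sin θ := by
  rw [radialPartial, radialPartial, norm_smul_polarDir, abs_of_pos hr, PiLp.smul_apply,
    PiLp.smul_apply, polarDir_apply_zero, polarDir_apply_one, smul_eq_mul, smul_eq_mul,
    mul_div_cancel_left₀ _ hr.ne', mul_div_cancel_left₀ _ hr.ne']
  exact ⟨rfl, rfl⟩

section Classification

variable {n : ℕ} {A : Matrix (Fin n) (Fin n) ℝ} {u φ : Fin n → Plane → ℝ}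

lemma abs_circleMode_le_of_growth {k : ℝ} {κ κ' : ℝ → ℝ} (hκ : IsAngularMode k κ κ') {C σ : ℝ}
    (hgrowth : ∀ i x, |φ i x| ≤ C * (1 + ‖x‖) ^ σ) (i : Fin n) {r : ℝ} (hr : 0 ≤ r) :
    |circleMode (φ i) κ r| ≤ 2 * Real.pi * C * (1 + r) ^ σ := by
  rw [mul_assoc]
  refine abs_circleMode_le hκ fun θ => ?_
  have := hgrowth i (r • polarDir θ)
  rwa [norm_smul_polarDir, abs_of_nonneg hr] at this

/-- With growth of order less than `2`, only the modes of frequency `0` and `1` survive. -/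
lemma eq_of_growth_lt_two (hA : IsH1 A) (hu : IsLiouvilleSolution A u)
    (hrad : ∀ i, IsRadial (u i)) (hφ : IsLinearizedSolution A u φ) {C σ : ℝ} (hσ : 0 ≤ σ)
    (hσ2 : σ < 2) (hgrowth : ∀ i x, |φ i x| ≤ C * (1 + ‖x‖) ^ σ) (i : Fin n) {r : ℝ} (hr : 0 < r)
    (θ : ℝ) :
    φ i (r • polarDir θ) = (2 * Real.pi)⁻¹ * circleMode (φ i) (fun θ => Real.cos ((0 : ℕ) * θ)) r
      + Real.pi⁻¹ * (circleMode (φ i) (fun θ => Real.cos ((1 : ℕ) * θ)) r * Real.cos θ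
        + circleMode (φ i) (fun θ => Real.sin ((1 : ℕ) * θ)) r * Real.sin θ) := by
  have hU := IsRadial.isLiouvilleProfile hu hrad
  have key : ∀ (k : ℕ) (κ κ' : ℝ → ℝ), 2 ≤ k → IsAngularMode k κ κ' → circleMode (φ i) κ r = 0 := by
    intro k κ κ' hk hκ
    have hk' : (2 : ℝ) ≤ k := by exact_mod_cast hk
    exact (hφ.isModeSolution hrad hκ).eq_zero_of_one_lt hU hA (by linarith) hσ (by linarith)
      (fun i r hr => abs_circleMode_le_of_growth hκ hgrowth i hr) i r hr
  exact eq_of_circleMode_eq_zero (hφ.contDiff i).continuous r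
    (fun k hk => key k _ _ hk (isAngularMode_cos k))
    (fun k hk => key k _ _ hk (isAngularMode_sin k)) θ

/-- With growth of order less than `1`, the modes of frequency `1` come from translations. -/
lemma exists_circleMode_one_eq [NeZero n] (hA : IsH1 A) (hu : IsLiouvilleSolution A u)
    (hrad : ∀ i, IsRadial (u i)) (hφ : IsLinearizedSolution A u φ) {C σ : ℝ} (hσ : 0 ≤ σ)
    (hσ1 : σ < 1) (hgrowth : ∀ i x, |φ i x| ≤ C * (1 + ‖x‖) ^ σ) :
    ∃ a b : ℝ, ∀ i r, 0 < r →
      circleMode (φ i) (fun θ => Real.cos ((1 : ℕ) * θ)) r = a * radialDeriv (u i) r ∧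
      circleMode (φ i) (fun θ => Real.sin ((1 : ℕ) * θ)) r = b * radialDeriv (u i) r := by
  have hU := IsRadial.isLiouvilleProfile hu hrad
  have hc := hφ.isModeSolution hrad (isAngularMode_cos 1)
  have hs := hφ.isModeSolution hrad (isAngularMode_sin 1)
  rw [Nat.cast_one] at hc hs
  obtain ⟨a, ha⟩ := hc.eq_const_mul_deriv hU hA (C := 2 * Real.pi * C) hσ hσ1
    fun i r hr => by
      have := abs_circleMode_le_of_growth (isAngularMode_cos 1) hgrowth i hr
      rwa [Nat.cast_one] at this
  obtain ⟨b, hb⟩ := hs.eq_const_mul_deriv hU hA (C := 2 * Real.pi * C) hσ hσ1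
    fun i r hr => by
      have := abs_circleMode_le_of_growth (isAngularMode_sin 1) hgrowth i hr
      rwa [Nat.cast_one] at this
  rw [Nat.cast_one]
  exact ⟨a, b, fun i r hr => ⟨ha i r hr, hb i r hr⟩⟩

/-- A solution vanishing at the origin has no modes of frequency `0`. -/
lemma circleMode_zero_eq_zero (hu : IsLiouvilleSolution A u)
    (hrad : ∀ i, IsRadial (u i)) (hφ : IsLinearizedSolution A u φ) (h0 : ∀ i, φ i 0 = 0)
    (i : Fin n) {r : ℝ} (hr : 0 ≤ r) :
    circleMode (φ i) (fun θ => Real.cos ((0 : ℕ) * θ)) r = 0 := by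
  have hU := IsRadial.isLiouvilleProfile hu hrad
  have hc := hφ.isModeSolution hrad (isAngularMode_cos 0)
  rw [Nat.cast_zero] at hc
  have := hc.eq_zero_of_apply_zero hU.continuous
    (fun i => by simp [circleMode, h0 i]) i r hr
  rw [Nat.cast_zero]
  exact this

/-- A solution vanishing to second order at the origin has no modes of frequency `1`. -/
lemma circleMode_one_eq_zero (hu : IsLiouvilleSolution A u)
    (hrad : ∀ i, IsRadial (u i)) (hφ : IsLinearizedSolution A u φ)
    (h0 : ∀ i, φ i =O[𝓝 0] fun x : Plane => ‖x‖ ^ 2) {κ κ' : ℝ → ℝ} (hκ : IsAngularMode 1 κ κ')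
    (i : Fin n) {r : ℝ} (hr : 0 ≤ r) : circleMode (φ i) κ r = 0 := by
  have hU := IsRadial.isLiouvilleProfile hu hrad
  have hm := hφ.isModeSolution hrad hκ
  refine hm.eq_zero_of_deriv_zero hU.continuous (fun i => ?_) i r hr
  refine tendsto_nhds_unique (hm.tendsto_div (hm.apply_zero one_ne_zero i)) ?_
  obtain ⟨C, hC⟩ := (h0 i).bound
  obtain ⟨ε, hε, hball⟩ := Metric.eventually_nhds_iff.1 hC
  have hlim : Filter.Tendsto (fun r : ℝ => 2 * Real.pi * C * r) (𝓝[>] 0) (𝓝 0) := by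
    have : Continuous fun r : ℝ => 2 * Real.pi * C * r := by fun_prop
    simpa using (this.tendsto 0).mono_left (nhdsWithin_le_nhds (s := Set.Ioi 0))
  refine squeeze_zero_norm' ?_ hlim
  filter_upwards [Ioo_mem_nhdsGT hε] with s hs
  have h1 : |circleMode (φ i) κ s| ≤ 2 * Real.pi * (C * s ^ 2) := by
    refine abs_circleMode_le hκ fun θ => ?_
    have h2 := hball (y := s • polarDir θ) (by
      rw [dist_zero_right, norm_smul_polarDir, abs_of_pos hs.1]
      exact hs.2)
    rwa [norm_smul_polarDir, abs_of_pos hs.1, norm_pow, Real.norm_of_nonneg hs.1.le,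
      Real.norm_eq_abs] at h2
  rw [norm_div, Real.norm_of_nonneg hs.1.le, div_le_iff₀ hs.1]
  calc ‖circleMode (φ i) κ s‖ ≤ 2 * Real.pi * (C * s ^ 2) := h1
    _ = 2 * Real.pi * C * s * s := by ring

end Classification

theorem theorem2p1 {n : ℕ} (A : Matrix (Fin n) (Fin n) ℝ) (hA : IsH1 A)
    (u : Fin n → Plane → ℝ) (hu : IsLiouvilleSolution A u) (hrad : ∀ i, IsRadial (u i))
    (φ : Fin n → Plane → ℝ) (hφ : IsLinearizedSolution A u φ) :
    ((∃ τ : ℝ, 0 < τ ∧ τ < 1 ∧ ∃ C : ℝ, ∀ i x, |φ i x| ≤ C * (1 + ‖x‖) ^ τ) →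
      (∀ i, φ i 0 = 0) →
      ∃ c₁ c₂ : ℝ, ∀ i x,
        φ i x = c₁ * radialPartial (u i) 0 x + c₂ * radialPartial (u i) 1 x) ∧
    ((∃ C : ℝ, ∀ i x, |φ i x| ≤ C) →
      ∃ c₀ c₁ c₂ : ℝ, ∀ i x,
        φ i x = c₀ * (‖x‖ * radialDeriv (u i) ‖x‖ + 2)
          + c₁ * radialPartial (u i) 0 x + c₂ * radialPartial (u i) 1 x) ∧
    ((∀ i, φ i =O[𝓝 0] fun x : Plane => ‖x‖ ^ 2) →
      (∃ ε₀ : ℝ, 0 < ε₀ ∧ ∃ C : ℝ, ∀ i x, |φ i x| ≤ C * (1 + ‖x‖) ^ (2 - ε₀)) →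
      ∀ i x, φ i x = 0) := by
  have hU := IsRadial.isLiouvilleProfile hu hrad
  rcases n.eq_zero_or_pos with rfl | hn
  · exact ⟨fun _ _ => ⟨0, 0, fun i => i.elim0⟩, fun _ => ⟨0, 0, 0, fun i => i.elim0⟩,
      fun _ _ i => i.elim0⟩
  have : NeZero n := ⟨hn.ne'⟩
  refine ⟨?_, ?_, ?_⟩
  · rintro ⟨τ, hτ, hτ1, C, hC⟩ h0
    obtain ⟨a, b, hab⟩ := exists_circleMode_one_eq hA hu hrad hφ hτ.le hτ1 hC
    refine ⟨Real.pi⁻¹ * a, Real.pi⁻¹ * b, fun i x => ?_⟩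
    rcases eq_or_ne x 0 with rfl | hx
    · simp [h0, radialPartial_zero]
    obtain ⟨θ, hθ⟩ := exists_eq_smul_polarDir x
    have hr : 0 < ‖x‖ := norm_pos_iff.2 hx
    generalize ‖x‖ = r at hθ hr
    rw [hθ, eq_of_growth_lt_two hA hu hrad hφ hτ.le (by linarith) hC i hr θ,
      circleMode_zero_eq_zero hu hrad hφ h0 i hr.le, (hab i r hr).1, (hab i r hr).2,
      (radialPartial_smul_polarDir (u i) hr θ).1, (radialPartial_smul_polarDir (u i) hr θ).2]
    ring
  · rintro ⟨C, hC⟩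
    have hC' : ∀ i x, |φ i x| ≤ C * (1 + ‖x‖) ^ (0 : ℝ) := fun i x => by
      rw [Real.rpow_zero, mul_one]; exact hC i x
    obtain ⟨a, b, hab⟩ := exists_circleMode_one_eq hA hu hrad hφ le_rfl one_pos hC'
    have hm := hφ.isModeSolution hrad (isAngularMode_cos 0)
    rw [Nat.cast_zero] at hm
    obtain ⟨M, hM⟩ := hm.eq_const_mul_of_bounded hU hA (C := 2 * Real.pi * C) fun i r hr => by
      have := abs_circleMode_le_of_growth (isAngularMode_cos 0) hC' i hr
      rwa [Real.rpow_zero, mul_one, Nat.cast_zero] at this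
    have hpolar : ∀ i r θ, 0 < r → φ i (r • polarDir θ)
        = (2 * Real.pi)⁻¹ * M * (r * radialDeriv (u i) r + 2)
          + Real.pi⁻¹ * a * (radialDeriv (u i) r * Real.cos θ)
          + Real.pi⁻¹ * b * (radialDeriv (u i) r * Real.sin θ) := by
      intro i r θ hr
      have h1 := hM i r hr
      rw [eq_of_growth_lt_two hA hu hrad hφ le_rfl two_pos hC' i hr θ, (hab i r hr).1,
        (hab i r hr).2, Nat.cast_zero, h1]
      ring
    refine ⟨(2 * Real.pi)⁻¹ * M, Real.pi⁻¹ * a, Real.pi⁻¹ * b, fun i x => ?_⟩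
    rcases eq_or_ne x 0 with rfl | hx
    · -- the value at the origin is the limit along a ray
      have hφc := (hφ.contDiff i).continuous
      have hUc := hU.continuous' i
      have h1 : Continuous fun r : ℝ => φ i (r • polarDir 0) := by fun_prop
      have h2 : Continuous fun r : ℝ => (2 * Real.pi)⁻¹ * M * (r * radialDeriv (u i) r + 2)
          + Real.pi⁻¹ * a * (radialDeriv (u i) r * Real.cos 0)
          + Real.pi⁻¹ * b * (radialDeriv (u i) r * Real.sin 0) := by fun_prop
      have h3 := tendsto_nhds_unique
        ((h1.tendsto 0).mono_left (nhdsWithin_le_nhds (s := Set.Ioi 0)))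
        (((h2.tendsto 0).mono_left (nhdsWithin_le_nhds (s := Set.Ioi 0))).congr' (by
          filter_upwards [self_mem_nhdsWithin] with r hr
          exact (hpolar i r 0 hr).symm))
      have h4 : radialDeriv (u i) 0 = 0 := hU.deriv_zero i
      simpa [radialPartial_zero, h4] using h3
    obtain ⟨θ, hθ⟩ := exists_eq_smul_polarDir x
    have hr : 0 < ‖x‖ := norm_pos_iff.2 hx
    have h1 := hpolar i ‖x‖ θ hr
    have h2 := radialPartial_smul_polarDir (u i) hr θ
    rw [← hθ] at h1 h2
    rw [h1, h2.1, h2.2]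
  · rintro h0 ⟨ε₀, hε₀, C, hC⟩ i x
    have hφ0 : ∀ i, φ i 0 = 0 := fun i => by
      obtain ⟨K, hK⟩ := (h0 i).bound
      simpa using hK.self_of_nhds
    have hC0 : 0 ≤ C := by
      have := (abs_nonneg _).trans (hC i 0)
      simpa using this
    have hC' : ∀ i x, |φ i x| ≤ C * (1 + ‖x‖) ^ max (2 - ε₀) 0 := fun i x =>
      (hC i x).trans (mul_le_mul_of_nonneg_left
        (Real.rpow_le_rpow_of_exponent_le (by linarith [norm_nonneg x]) (le_max_left _ _)) hC0)
    rcases eq_or_ne x 0 with rfl | hx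
    · exact hφ0 i
    obtain ⟨θ, hθ⟩ := exists_eq_smul_polarDir x
    have hr : 0 < ‖x‖ := norm_pos_iff.2 hx
    have hc := isAngularMode_cos 1
    have hs := isAngularMode_sin 1
    rw [Nat.cast_one] at hc hs
    generalize ‖x‖ = r at hθ hr
    rw [hθ, eq_of_growth_lt_two hA hu hrad hφ (le_max_right _ _)
        (max_lt (by linarith) two_pos) hC' i hr θ,
      circleMode_zero_eq_zero hu hrad hφ hφ0 i hr.le, Nat.cast_one,
      circleMode_one_eq_zero hu hrad hφ h0 hc i hr.le,
      circleMode_one_eq_zero hu hrad hφ h0 hs i hr.le]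
    ring
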